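/- **Theorem 1.5.** All graphs are finite and simple, with at least one vertex, and integers $t$ below are positive. An edge-ordered graph is a graph together with a total order of its edge set. A copy of an edge-ordered graph $F$ in an edge-ordered graph $G$ is a (not necessarily induced) subgraph of $G$ which, with the order of its edges inherited from $G$, is isomorphic to $F$ as an edge-ordered graph; isolated vertices of $F$ count as vertices of the copy. A perfect $F$-tiling in $G$ is a collection of vertex-disjoint copies of $F$ in $G$ that together cover all vertices of $G$. An edge-ordered graph $F$ on $f$ vertices is *Turánable* if there is a positive integer $t$ such that every edge-ordering of the complete graph $K_t$ contains a copy of $F$, and *tileable* if there is a positive integer $t$ divisible by $f$ such that every edge-ordering of $K_t$ contains a perfect $F$-tiling. Let $H$ be a graph. The following are equivalent: (a) $H$ is universally tileable: for every total order of $E(H)$, the resulting edge-ordered graph is tileable; (b) $H$ is universally Turánable: for every total order of $E(H)$, the resulting edge-ordered graph is Turánable; (c) one of the following holds: (i) $H$ is a star forest, possibly with isolated vertices (that is, every connected component of $H$ is a single vertex or a star $K_{1,s}$ with $s\ge 1$); (ii) $H$ is a path on three edges together with a (possibly empty) collection of isolated vertices; (iii) $H$ is a copy of $K_3$ together with a (possibly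 empty) collection of isolated vertices. -/

import Mathlib

/-- An edge-ordered graph: a graph together with a total order of its edge set. -/
structure EdgeOrderedGraph (V : Type*) where
  graph : SimpleGraph V
  order : LinearOrder graph.edgeSet

namespace EdgeOrderedGraph

/-- A copy of `F` in `G`: a copy of the underlying graph of `F` in the underlying graph of `G`
(an injective map of all the vertices of `F` that sends edges to edges), such that the order of the
edges of `F` is the one inherited from the order of the edges of `G`. -/
structure Copy {V W : Type*} (F : EdgeOrderedGraph V) (G : EdgeOrderedGraph W) where
  toCopy : SimpleGraph.Copy F.graph G.graph
  le_iff_le : ∀ e e' : F.graph.edgeSet,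
    G.order.le (toCopy.mapEdgeSet e) (toCopy.mapEdgeSet e') ↔ F.order.le e e'

/-- The set of vertices of `G` that a copy of `F` in `G` occupies. -/
def Copy.verts {V W : Type*} {F : EdgeOrderedGraph V} {G : EdgeOrderedGraph W}
    (c : F.Copy G) : Set W :=
  Set.range c.toCopy

/-- `G` contains `F` if there is a copy of `F` in `G`. -/
def Contains {V W : Type*} (G : EdgeOrderedGraph W) (F : EdgeOrderedGraph V) : Prop :=
  Nonempty (F.Copy G)

/-- A perfect `F`-tiling in `G`: a collection of vertex-disjoint copies of `F` in `G` that together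
cover all the vertices of `G`. -/
def IsPerfectTiling {V W : Type*} (F : EdgeOrderedGraph V) (G : EdgeOrderedGraph W)
    (T : Set (F.Copy G)) : Prop :=
  T.PairwiseDisjoint Copy.verts ∧ ⋃ c ∈ T, c.verts = Set.univ

/-- The complete graph `K_t` with the given total order of its edge set. -/
def complete (t : ℕ) (o : LinearOrder (SimpleGraph.completeGraph (Fin t)).edgeSet) :
    EdgeOrderedGraph (Fin t) :=
  ⟨SimpleGraph.completeGraph (Fin t), o⟩

/-- `F` is Turánable if for some positive integer `t` every edge-ordering of `K_t` contains a copy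
of `F`. -/
def Turanable {V : Type*} (F : EdgeOrderedGraph V) : Prop :=
  ∃ t : ℕ, 0 < t ∧ ∀ o : LinearOrder (SimpleGraph.completeGraph (Fin t)).edgeSet,
    (complete t o).Contains F

/-- `F`, on `f` vertices, is tileable if for some positive integer `t` divisible by `f` every
edge-ordering of `K_t` contains a perfect `F`-tiling. -/
def Tileable {V : Type*} [Fintype V] (F : EdgeOrderedGraph V) : Prop :=
  ∃ t : ℕ, 0 < t ∧ Fintype.card V ∣ t ∧
    ∀ o : LinearOrder (SimpleGraph.completeGraph (Fin t)).edgeSet,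
      ∃ T : Set (F.Copy (complete t o)), F.IsPerfectTiling (complete t o) T

end EdgeOrderedGraph

/-- Every edge-ordering of `H` is tileable. -/
def UniversallyTileable {V : Type*} [Fintype V] (H : SimpleGraph V) : Prop :=
  ∀ o : LinearOrder H.edgeSet, (EdgeOrderedGraph.mk H o).Tileable

/-- Every edge-ordering of `H` is Turánable. -/
def UniversallyTuranable {V : Type*} (H : SimpleGraph V) : Prop :=
  ∀ o : LinearOrder H.edgeSet, (EdgeOrderedGraph.mk H o).Turanable

/-- Every connected component of `H` is a star: it has a vertex, the centre, such that the edges of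
the component are exactly the pairs consisting of the centre and another vertex. A component with
a single vertex (an isolated vertex of `H`) is allowed. -/
def IsStarForest {V : Type*} (H : SimpleGraph V) : Prop :=
  ∀ c : H.ConnectedComponent, ∃ r, c.toSimpleGraph = SimpleGraph.starGraph r

/-- `H` is a path on three edges together with `m ≥ 0` isolated vertices. -/
def IsThreeEdgePathWithIsolated {V : Type*} (H : SimpleGraph V) : Prop :=
  ∃ m : ℕ, Nonempty (H ≃g SimpleGraph.sum (SimpleGraph.pathGraph 4) (⊥ : SimpleGraph (Fin m)))

/-- `H` is a triangle together with `m ≥ 0` isolated vertices. -/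
def IsTriangleWithIsolated {V : Type*} (H : SimpleGraph V) : Prop :=
  ∃ m : ℕ, Nonempty (H ≃g SimpleGraph.sum (SimpleGraph.completeGraph (Fin 3))
    (⊥ : SimpleGraph (Fin m)))

/-! A tiling of a nonempty vertex set contains a copy, so tileable implies Turánable.

To see what universal Turánability forces, order the edges of a clique lexicographically by smaller
end. A copy in this clique numbers the vertices of `H` so that the smaller ends never decrease along
the edge order (`UniversallyTuranable.exists_numbering`). A triangle or a three-edge path together
with any further edge has an edge order that admits no such numbering (`false_of_triangle_of_edge`,
`false_of_path_of_edge`). So a triangle or three-edge path in `H` already carries all its edges, and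
a graph with neither is a star forest.

Conversely, it suffices that every vertex of every large edge-ordered clique lies in a copy
(`CoversVertices.tileable`). Ramsey's theorem then gives a large set `A` in which every subset of
the right size spans a copy. Tile the outside of `A` greedily, absorb the bounded remainder using
vertices of `A`, and cut what is left of `A` arbitrarily.

The covering property is elementary for triangles and paths: all orders of a triangle are
isomorphic, and extreme edges give the paths. For star forests, Ramsey's theorem yields leaves and
centres such that the leaf decides the order of disjoint edges, while the prescribed vertex serves
as the leaf of an extreme edge (`exists_leaves_and_centres`). -/

/-! ### Ramsey's theorem -/

/-- Ramsey's theorem for two colours and `k`-element sets. -/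
theorem Finset.exists_ramsey (k a b : ℕ) : ∃ N, ∀ {α : Type} (P : Finset α → Prop)
    (S : Finset α), N ≤ S.card →
      (∃ T ⊆ S, T.card = a ∧ ∀ U ⊆ T, U.card = k → P U) ∨
      (∃ T ⊆ S, T.card = b ∧ ∀ U ⊆ T, U.card = k → ¬ P U) := by
  classical
  induction k generalizing a b with
  | zero =>
    refine ⟨max a b, fun P S hS => ?_⟩
    by_cases h : P ∅
    · obtain ⟨T, hT, hc⟩ := Finset.exists_subset_card_eq ((le_max_left a b).trans hS)
      refine .inl ⟨T, hT, hc, fun U _ hU => ?_⟩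
      rwa [Finset.card_eq_zero.1 hU]
    · obtain ⟨T, hT, hc⟩ := Finset.exists_subset_card_eq ((le_max_right a b).trans hS)
      refine .inr ⟨T, hT, hc, fun U _ hU => ?_⟩
      rwa [Finset.card_eq_zero.1 hU]
  | succ k ih =>
    induction hn : a + b generalizing a b with
    | zero =>
      refine ⟨0, fun P S _ => .inl ⟨∅, by simp, by simp; omega, fun U hU hc => ?_⟩⟩
      rw [Finset.subset_empty.1 hU] at hc
      simp at hc
    | succ n ihn =>
      rcases a with _ | a
      · refine ⟨0, fun P S _ => .inl ⟨∅, by simp, by simp, fun U hU hc => ?_⟩⟩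
        rw [Finset.subset_empty.1 hU] at hc
        simp at hc
      rcases b with _ | b
      · refine ⟨0, fun P S _ => .inr ⟨∅, by simp, by simp, fun U hU hc => ?_⟩⟩
        rw [Finset.subset_empty.1 hU] at hc
        simp at hc
      -- Erdős–Szekeres recursion: colour each `k`-set `U` avoiding `v` by the colour of `insert v
      -- U`. Inside a homogeneous set for this colouring, `v` can be added to a homogeneous set of
      -- the same colour, so one target drops by one.
      obtain ⟨N₁, h₁⟩ := ihn a (b + 1) (by omega)
      obtain ⟨N₂, h₂⟩ := ihn (a + 1) b (by omega)
      obtain ⟨N, hN⟩ := ih N₁ N₂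
      refine ⟨N + 1, fun {α} P S hS => ?_⟩
      obtain ⟨v, hv⟩ := Finset.card_pos.1 (show 0 < S.card by omega)
      have hext : ∀ (Q : Finset α → Prop) (T T' : Finset α), v ∉ T → T' ⊆ T →
          (∀ U ⊆ T, U.card = k → Q (insert v U)) →
          (∀ U ⊆ T', U.card = k + 1 → Q U) →
          ∀ U ⊆ insert v T', U.card = k + 1 → Q U := by
        intro Q T T' hvT hT' hQ hQ' U hU hc
        by_cases hvU : v ∈ U
        · have h := hQ (U.erase v) (fun y hy => ?_) (by rw [Finset.card_erase_of_mem hvU]; omega)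
          · rwa [Finset.insert_erase hvU] at h
          · obtain ⟨hy1, hy2⟩ := Finset.mem_erase.1 hy
            exact hT' ((Finset.mem_insert.1 (hU hy2)).resolve_left hy1)
        · exact hQ' U ((Finset.subset_insert_iff_of_notMem hvU).1 hU) hc
      have hsub : ∀ {T T' : Finset α}, T ⊆ S.erase v → T' ⊆ T → insert v T' ⊆ S := by
        intro T T' h h' y hy
        rcases Finset.mem_insert.1 hy with rfl | hy
        · exact hv
        · exact Finset.mem_of_mem_erase (h (h' hy))
      rcases hN (fun U => P (insert v U)) (S.erase v)
          (by rw [Finset.card_erase_of_mem hv]; omega) with ⟨T, hT, hc, hP⟩ | ⟨T, hT, hc, hP⟩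
      · have hvT : v ∉ T := fun h => by simpa using hT h
        rcases h₁ P T hc.ge with ⟨T', hT', hc', hP'⟩ | ⟨T', hT', hc', hP'⟩
        · refine .inl ⟨insert v T', hsub hT hT', ?_, hext P T T' hvT hT' hP hP'⟩
          rw [Finset.card_insert_of_notMem fun h => hvT (hT' h), hc']
        · exact .inr ⟨T', hT'.trans (hT.trans (Finset.erase_subset _ _)), hc', hP'⟩
      · have hvT : v ∉ T := fun h => by simpa using hT h
        rcases h₂ P T hc.ge with ⟨T', hT', hc', hP'⟩ | ⟨T', hT', hc', hP'⟩
        · exact .inl ⟨T', hT'.trans (hT.trans (Finset.erase_subset _ _)), hc', hP'⟩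
        · refine .inr ⟨insert v T', hsub hT hT', ?_,
            hext (fun U => ¬ P U) T T' hvT hT' hP hP'⟩
          rw [Finset.card_insert_of_notMem fun h => hvT (hT' h), hc']

/-- A 3-set has exactly one increasing enumeration, so a relation on increasing triples is a
colouring of 3-sets. Quantifying over all increasing triples of the set expresses it without
choosing the enumeration. -/
theorem Finset.exists_ramsey_triples (m : ℕ) : ∃ N, ∀ {α : Type} [LinearOrder α]
    (R : α → α → α → Prop) (S : Finset α), N ≤ S.card → ∃ T ⊆ S, T.card = m ∧
      ((∀ a ∈ T, ∀ b ∈ T, ∀ c ∈ T, a < b → b < c → R a b c) ∨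
       (∀ a ∈ T, ∀ b ∈ T, ∀ c ∈ T, a < b → b < c → ¬ R a b c)) := by
  obtain ⟨N, hN⟩ := Finset.exists_ramsey 3 m m
  refine ⟨N, fun {α} _ R S hS => ?_⟩
  have key : ∀ a b c : α, a < b → b < c → (R a b c ↔ ∀ a' ∈ ({a, b, c} : Finset α),
      ∀ b' ∈ ({a, b, c} : Finset α), ∀ c' ∈ ({a, b, c} : Finset α),
        a' < b' → b' < c' → R a' b' c') := by
    intro a b c hab hbc
    refine ⟨fun h a' ha b' hb c' hc h₁ h₂ => ?_, fun h => h a (by simp) b (by simp) c (by simp)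
      hab hbc⟩
    simp only [Finset.mem_insert, Finset.mem_singleton] at ha hb hc
    grind
  rcases hN (fun U => ∀ a ∈ U, ∀ b ∈ U, ∀ c ∈ U, a < b → b < c → R a b c) S hS with
    ⟨T, hT, hc, h⟩ | ⟨T, hT, hc, h⟩
  · refine ⟨T, hT, hc, .inl fun a ha b hb c hc hab hbc => (key a b c hab hbc).2 (h _ ?_ ?_)⟩
    · simp [Finset.insert_subset_iff, *]
    · exact Finset.card_eq_three.2 ⟨a, b, c, hab.ne, (hab.trans hbc).ne, hbc.ne, rfl⟩
  · refine ⟨T, hT, hc, .inr fun a ha b hb c hc hab hbc hR =>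
      h {a, b, c} ?_ ?_ ((key a b c hab hbc).1 hR)⟩
    · simp [Finset.insert_subset_iff, *]
    · exact Finset.card_eq_three.2 ⟨a, b, c, hab.ne, (hab.trans hbc).ne, hbc.ne, rfl⟩

theorem Finset.exists_ramsey_quadruples (m : ℕ) : ∃ N, ∀ {α : Type} [LinearOrder α]
    (R : α → α → α → α → Prop) (S : Finset α), N ≤ S.card → ∃ T ⊆ S, T.card = m ∧
      ((∀ a ∈ T, ∀ b ∈ T, ∀ c ∈ T, ∀ d ∈ T, a < b → b < c → c < d → R a b c d) ∨
       (∀ a ∈ T, ∀ b ∈ T, ∀ c ∈ T, ∀ d ∈ T, a < b → b < c → c < d → ¬ R a b c d)) := by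
  obtain ⟨N, hN⟩ := Finset.exists_ramsey 4 m m
  refine ⟨N, fun {α} _ R S hS => ?_⟩
  have hcard : ∀ a b c d : α, a < b → b < c → c < d → ({a, b, c, d} : Finset α).card = 4 := by
    intro a b c d h₁ h₂ h₃
    have := (h₁.trans h₂)
    have := (h₂.trans h₃)
    have := (h₁.trans this)
    simp [*, ne_of_lt]
  have key : ∀ a b c d : α, a < b → b < c → c < d →
      (R a b c d ↔ ∀ a' ∈ ({a, b, c, d} : Finset α),
      ∀ b' ∈ ({a, b, c, d} : Finset α), ∀ c' ∈ ({a, b, c, d} : Finset α),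
      ∀ d' ∈ ({a, b, c, d} : Finset α), a' < b' → b' < c' → c' < d' → R a' b' c' d') := by
    intro a b c d hab hbc hcd
    refine ⟨fun h a' ha b' hb c' hc d' hd h₁ h₂ h₃ => ?_,
      fun h => h a (by simp) b (by simp) c (by simp) d (by simp) hab hbc hcd⟩
    simp only [Finset.mem_insert, Finset.mem_singleton] at ha hb hc hd
    have hb' : b' = b ∨ b' = c := by
      rcases hb with rfl | rfl | rfl | rfl <;> grind
    have hc' : c' = c := by grind
    grind
  rcases hN (fun U => ∀ a ∈ U, ∀ b ∈ U, ∀ c ∈ U, ∀ d ∈ U,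
      a < b → b < c → c < d → R a b c d) S hS with ⟨T, hT, hc, h⟩ | ⟨T, hT, hc, h⟩
  · refine ⟨T, hT, hc, .inl fun a ha b hb c hc d hd hab hbc hcd =>
      (key a b c d hab hbc hcd).2 (h _ ?_ (hcard a b c d hab hbc hcd))⟩
    simp [Finset.insert_subset_iff, *]
  · refine ⟨T, hT, hc, .inr fun a ha b hb c hc d hd hab hbc hcd hR =>
      h {a, b, c, d} ?_ (hcard a b c d hab hbc hcd) ((key a b c d hab hbc hcd).1 hR)⟩
    simp [Finset.insert_subset_iff, *]

/-! ### Tiling by greedy removal and absorption -/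

/-- `S` is a disjoint union of `f`-element sets with property `P`. -/
inductive Finset.Tiled {α : Type} (P : Finset α → Prop) (f : ℕ) : Finset α → Prop
  | empty : Finset.Tiled P f ∅
  | disjUnion (S U : Finset α) (h : Disjoint U S) : P U → U.card = f → Finset.Tiled P f S →
      Finset.Tiled P f (U.disjUnion S h)

namespace Finset.Tiled

variable {α : Type} {P : Finset α → Prop} {f : ℕ}

theorem dvd_card {S : Finset α} (h : Tiled P f S) : f ∣ S.card := by
  induction h with
  | empty => simp
  | disjUnion S U h _ hU _ ih => rw [card_disjUnion, hU]; exact dvd_add dvd_rfl ih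

theorem union [DecidableEq α] {S S' : Finset α} (h : Tiled P f S) (h' : Tiled P f S')
    (hd : Disjoint S S') : Tiled P f (S ∪ S') := by
  induction h with
  | empty => simpa
  | disjUnion S U h hP hU _ ih =>
    rw [disjUnion_eq_union, disjoint_union_left] at hd
    have hUS : Disjoint U (S ∪ S') := disjoint_union_right.2 ⟨h, hd.1⟩
    have := disjUnion _ U hUS hP hU (ih hd.2)
    rwa [disjUnion_eq_union, ← union_assoc, ← disjUnion_eq_union _ _ h] at this

theorem of_mem [DecidableEq α] {U : Finset α} (hP : P U) (hU : U.card = f) : Tiled P f U := by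
  simpa using disjUnion _ _ (disjoint_empty_right U) hP hU (empty (P := P) (f := f))

theorem exists_family {S : Finset α} (h : Tiled P f S) :
    ∃ F : Set (Finset α), (∀ U ∈ F, P U ∧ U ⊆ S) ∧ F.PairwiseDisjoint id ∧
      ∀ x ∈ S, ∃ U ∈ F, x ∈ U := by
  classical
  induction h with
  | empty => exact ⟨∅, by simp, by simp, by simp⟩
  | disjUnion S U h hP hU _ ih =>
    obtain ⟨F, h₁, h₂, h₃⟩ := ih
    refine ⟨insert U F, ?_, ?_, ?_⟩
    · rintro W (rfl | hW)
      · exact ⟨hP, by simp⟩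
      · exact ⟨(h₁ W hW).1, (h₁ W hW).2.trans (by simp)⟩
    · refine h₂.insert fun W hW _ => ?_
      exact h.mono_right (h₁ W hW).2
    · intro x hx
      rcases mem_disjUnion.1 hx with hx | hx
      · exact ⟨U, by simp, hx⟩
      · obtain ⟨W, hW, hxW⟩ := h₃ x hx
        exact ⟨W, by simp [hW], hxW⟩

/-- If every subset of size `f` has property `P`, then sets of size divisible by `f` are tiled. -/
theorem of_forall_subset (hf : 0 < f) (A : Finset α) (hA : ∀ U ⊆ A, U.card = f → P U)
    (hd : f ∣ A.card) : Tiled P f A := by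
  classical
  induction A using Finset.strongInduction with
  | H A ih =>
    rcases A.eq_empty_or_nonempty with rfl | hne
    · exact empty
    obtain ⟨U, hUA, hU⟩ := exists_subset_card_eq (Nat.le_of_dvd hne.card_pos hd)
    have hss : A \ U ⊂ A := sdiff_ssubset hUA (card_pos.1 (by omega))
    have := disjUnion (A \ U) U disjoint_sdiff (hA U hUA hU) hU
      (ih _ hss (fun W hW => hA W (hW.trans hss.1))
        (by rw [card_sdiff_of_subset hUA, hU]; exact Nat.dvd_sub hd dvd_rfl))
    rwa [disjUnion_eq_union, union_sdiff_of_subset hUA] at this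

theorem exists_greedy {n : ℕ} (hn : 0 < n)
    (hP : ∀ S : Finset α, ∀ x ∈ S, n ≤ S.card → ∃ U ⊆ S, x ∈ U ∧ U.card = f ∧ P U)
    (S : Finset α) : ∃ R ⊆ S, R.card < n ∧ ∃ S' ⊆ S, Tiled P f S' ∧ Disjoint S' R ∧
      ∀ x ∈ S, x ∈ S' ∨ x ∈ R := by
  classical
  induction S using Finset.strongInduction with
  | H S ih =>
    by_cases hS : S.card < n
    · exact ⟨S, Subset.rfl, hS, ∅, by simp, empty, by simp, fun x hx => .inr hx⟩
    push Not at hS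
    obtain ⟨x, hx⟩ := card_pos.1 (hn.trans_le hS)
    obtain ⟨U, hUS, hxU, hU, hPU⟩ := hP S x hx hS
    obtain ⟨R, hRS, hR, S', hS', hT, hd, hc⟩ := ih (S \ U) (sdiff_ssubset hUS ⟨x, hxU⟩)
    have hUS' : Disjoint U S' := disjoint_sdiff.mono_right hS'
    refine ⟨R, hRS.trans sdiff_subset, hR, U ∪ S',
      union_subset hUS (hS'.trans sdiff_subset), (of_mem hPU hU).union hT hUS',
      disjoint_union_left.2 ⟨disjoint_sdiff.mono_right hRS, hd⟩, fun y hy => ?_⟩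
    by_cases hyU : y ∈ U
    · exact .inl (mem_union_left _ hyU)
    · rcases hc y (mem_sdiff.2 ⟨hy, hyU⟩) with h | h
      · exact .inl (mem_union_right _ h)
      · exact .inr h

/-- Each vertex of `B` is covered by a block whose other vertices lie in `A`. A block uses fewer
than `f + 1` vertices of `A`, so the size bound leaves enough for the next one. -/
theorem exists_absorb {n : ℕ}
    (hP : ∀ S : Finset α, ∀ x ∈ S, n ≤ S.card → ∃ U ⊆ S, x ∈ U ∧ U.card = f ∧ P U)
    (B A : Finset α) (hAB : Disjoint B A) (hA : B.card * f + n ≤ A.card) [DecidableEq α] :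
    ∃ A' ⊆ A, Tiled P f (B ∪ A') := by
  induction B using Finset.induction_on generalizing A with
  | empty => exact ⟨∅, by simp, by simpa using empty⟩
  | insert x B hxB ih =>
    rw [card_insert_of_notMem hxB] at hA
    rw [disjoint_insert_left] at hAB
    obtain ⟨U, hUA, hxU, hU, hPU⟩ := hP (insert x A) x (by simp)
      (by rw [card_insert_of_notMem hAB.1]; grind)
    have hUA' : U.erase x ⊆ A := fun y hy => by
      have := hUA (mem_of_mem_erase hy)
      have := ne_of_mem_erase hy
      grind
    obtain ⟨A', hA', hT⟩ := ih (A \ U) (hAB.2.mono_right sdiff_subset) (by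
      have h₁ := le_card_sdiff U A
      rw [hU] at h₁
      have : (B.card + 1) * f = B.card * f + f := by ring
      omega)
    have hd : Disjoint U (B ∪ A') := by
      refine disjoint_union_right.2 ⟨?_, disjoint_sdiff.mono_right hA'⟩
      rw [← insert_erase hxU, disjoint_insert_left]
      exact ⟨hxB, (hAB.2.mono_right hUA').symm⟩
    refine ⟨U.erase x ∪ A', union_subset hUA' (hA'.trans sdiff_subset), ?_⟩
    have := (of_mem hPU hU).union hT hd
    convert this using 1
    conv_rhs => rw [← insert_erase hxU]
    ext y
    simp only [mem_union, mem_insert]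
    tauto

/-- If every vertex of every large set lies in a set of the family `P` inside that set,
then the ground set is tiled, provided its size is suitably chosen. -/
theorem exists_card_univ (n f : ℕ) (hf : 0 < f) : ∃ t, 0 < t ∧ f ∣ t ∧
    ∀ P : Finset (Fin t) → Prop,
      (∀ S : Finset (Fin t), ∀ x ∈ S, n ≤ S.card → ∃ U ⊆ S, x ∈ U ∧ U.card = f ∧ P U) →
      Tiled P f univ := by
  -- The first size is what absorbing at most `n + 1` leftover vertices requires. The second outcome
  -- is impossible, since a vertex of that set would lie in a block inside it. Using `n + 1` makes
  -- the threshold positive even for `n = 0`.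
  obtain ⟨N, hN⟩ := exists_ramsey f ((n + 1) * f + (n + 1)) (n + 1)
  refine ⟨f * (N + 1), by positivity, dvd_mul_right _ _, fun P hP => ?_⟩
  have hP' : ∀ S : Finset (Fin (f * (N + 1))), ∀ x ∈ S, n + 1 ≤ S.card →
      ∃ U ⊆ S, x ∈ U ∧ U.card = f ∧ P U := fun S x hx h => hP S x hx (by omega)
  have hA : ∃ A : Finset (Fin (f * (N + 1))), A.card = (n + 1) * f + (n + 1) ∧
      ∀ U ⊆ A, U.card = f → P U := by
    rcases hN P univ (by simp; nlinarith) with ⟨T, -, hc, h⟩ | ⟨T, -, hc, h⟩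
    · exact ⟨T, hc, h⟩
    · obtain ⟨x, hx⟩ := card_pos.1 (show 0 < T.card by omega)
      obtain ⟨U, hUT, -, hU, hPU⟩ := hP' T x hx hc.ge
      exact absurd hPU (h U hUT hU)
  obtain ⟨A, hAc, hA⟩ := hA
  obtain ⟨R, hR, hRn, S', hS', hT, hd, hcov⟩ := exists_greedy n.succ_pos hP' Aᶜ
  have hRA : Disjoint R A := disjoint_compl_left.mono_left hR
  obtain ⟨A', hA', hT'⟩ := exists_absorb hP' R A hRA (by rw [hAc]; nlinarith)
  have hd' : Disjoint S' (R ∪ A') :=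
    disjoint_union_right.2 ⟨hd, disjoint_compl_left.mono hS' hA'⟩
  have h := hT.union hT' hd'
  have heq : (S' ∪ (R ∪ A'))ᶜ = A \ A' := by
    ext y
    have := @hcov y
    have := @hA' y
    have := @hS' y
    have := @hR y
    simp only [mem_compl, mem_union, mem_sdiff] at *
    tauto
  -- The rest lies in `A`, and its size is divisible by `f` because both the total and the tiled
  -- part are.
  have h' : Tiled P f (S' ∪ (R ∪ A'))ᶜ := by
    refine of_forall_subset hf _ (fun U hU => hA U (hU.trans ?_)) ?_
    · rw [heq]; exact sdiff_subset
    · rw [card_compl, Fintype.card_fin]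
      exact Nat.dvd_sub (dvd_mul_right _ _) h.dvd_card
  have := h.union h' disjoint_compl_right
  rwa [union_compl] at this

end Finset.Tiled

/-! ### Numerical labels for edge orders, and covering implies tileable -/

namespace LinearOrder

theorem exists_nat_lt_iff {α : Type*} [Finite α] (o : LinearOrder α) :
    ∃ g : α → ℕ, ∀ a b, g a < g b ↔ o.lt a b := by
  have := Fintype.ofFinite α
  let g := Fintype.orderIsoFinOfCardEq α rfl
  exact ⟨fun a => g.symm a, fun a b => Fin.lt_def.symm.trans g.symm.lt_iff_lt⟩

theorem le_iff_le_of_forall_lt {α β : Type*} (o : LinearOrder α) (o' : LinearOrder β)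
    {f : α → β} (hf : ∀ a b, o.lt a b → o'.lt (f a) (f b)) (a b : α) :
    o'.le (f a) (f b) ↔ o.le a b :=
  StrictMono.le_iff_le (f := f) (fun a b => hf a b)

theorem eq_of_not_lt {α : Type*} (o : LinearOrder α) {a b : α} (h₁ : ¬ o.lt a b)
    (h₂ : ¬ o.lt b a) : a = b :=
  le_antisymm (not_lt.1 h₂) (not_lt.1 h₁)

theorem lt_of_not_le {α : Type*} (o : LinearOrder α) {a b : α} (h : ¬ o.le a b) : o.lt b a :=
  not_le.1 h

end LinearOrder

namespace EdgeOrderedGraph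

/-- The order of the edges is induced by a labelling with natural numbers. -/
theorem exists_label {V : Type*} [Finite V] (F : EdgeOrderedGraph V) :
    ∃ w : Sym2 V → ℕ, ∀ e e' : F.graph.edgeSet, w e < w e' ↔ F.order.lt e e' := by
  classical
  obtain ⟨g, hg⟩ := F.order.exists_nat_lt_iff
  exact ⟨fun e => if h : e ∈ F.graph.edgeSet then g ⟨e, h⟩ else 0, fun e e' => by simp [← hg]⟩

/-- Every vertex of every large enough edge-ordered clique lies in a copy of `F`. -/
def CoversVertices {V : Type*} (F : EdgeOrderedGraph V) : Prop :=
  ∃ n : ℕ, ∀ (t : ℕ) (w : Sym2 (Fin t) → ℤ), Set.InjOn w {e | ¬ e.IsDiag} →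
    ∀ (S : Finset (Fin t)) (x : Fin t), x ∈ S → n ≤ S.card →
      ∃ φ : V → Fin t, Function.Injective φ ∧ (∀ v, φ v ∈ S) ∧ (∃ v, φ v = x) ∧
        ∀ e e' : F.graph.edgeSet, F.order.lt e e' → w (e.1.map φ) < w (e'.1.map φ)

theorem CoversVertices.tileable {V : Type*} [Fintype V] [Nonempty V] {F : EdgeOrderedGraph V}
    (hF : F.CoversVertices) : F.Tileable := by
  classical
  obtain ⟨n, hn⟩ := hF
  obtain ⟨t, ht, hd, h⟩ := Finset.Tiled.exists_card_univ n (Fintype.card V) Fintype.card_pos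
  refine ⟨t, ht, hd, fun o => ?_⟩
  obtain ⟨w, hw⟩ := (complete t o).exists_label
  have hlt : ∀ e e' : (complete t o).graph.edgeSet, w e < w e' ↔ o.lt e e' := hw
  have hinj : Set.InjOn (fun e => (w e : ℤ)) {e | ¬ e.IsDiag} := by
    intro e he e' he' heq
    have he : e ∈ (complete t o).graph.edgeSet := by simpa [complete] using he
    have he' : e' ∈ (complete t o).graph.edgeSet := by simpa [complete] using he'
    have heq : w e = w e' := by simpa using heq
    have h₁ := (hlt ⟨e, he⟩ ⟨e', he'⟩).not.1 heq.not_lt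
    have h₂ := (hlt ⟨e', he'⟩ ⟨e, he⟩).not.1 heq.not_gt
    exact congrArg Subtype.val (o.eq_of_not_lt h₁ h₂)
  have key := h (fun U => ∃ c : F.Copy (complete t o), c.verts = U) fun S x hx hS => by
    obtain ⟨φ, hφ, hφS, ⟨v, hv⟩, hlt'⟩ := hn t (fun e => (w e : ℤ)) hinj S x hx hS
    let f : F.graph →g (complete t o).graph := ⟨φ, fun {a b} hab => hφ.ne hab.ne⟩
    let c₀ : SimpleGraph.Copy F.graph (complete t o).graph := ⟨f, hφ⟩
    have hmono : ∀ e e' : F.graph.edgeSet, F.order.lt e e' →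
        o.lt (c₀.mapEdgeSet e) (c₀.mapEdgeSet e') := fun e e' hee => by
      have := hlt' e e' hee
      exact (hlt _ _).1 (by exact_mod_cast this)
    let c : F.Copy (complete t o) := ⟨c₀, F.order.le_iff_le_of_forall_lt o hmono⟩
    refine ⟨Finset.univ.image φ, ?_, ?_, ?_, c, ?_⟩
    · intro y hy
      obtain ⟨v, -, rfl⟩ := Finset.mem_image.1 hy
      exact hφS v
    · exact Finset.mem_image.2 ⟨v, Finset.mem_univ _, hv⟩
    · rw [Finset.card_image_of_injective _ hφ, Finset.card_univ]
    · simp only [Finset.coe_image, Finset.coe_univ, Set.image_univ]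
      rfl
  obtain ⟨𝒰, h₁, h₂, h₃⟩ := key.exists_family
  have hP : ∀ U : 𝒰, ∃ c : F.Copy (complete t o), c.verts = U.1 := fun U => (h₁ U.1 U.2).1
  choose c hc using hP
  refine ⟨Set.range c, ?_, ?_⟩
  · rintro _ ⟨U, rfl⟩ _ ⟨U', rfl⟩ hne
    have : U.1 ≠ U'.1 := fun h => hne (congrArg c (Subtype.ext h))
    have := h₂ U.2 U'.2 this
    simp only [Function.onFun, hc]
    exact_mod_cast this
  · refine Set.eq_univ_of_forall fun x => ?_
    obtain ⟨U, hU, hx⟩ := h₃ x (Finset.mem_univ x)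
    refine Set.mem_biUnion (Set.mem_range_self ⟨U, hU⟩) ?_
    rw [hc]
    exact hx

theorem Tileable.turanable {V : Type*} [Fintype V] {F : EdgeOrderedGraph V}
    (hF : F.Tileable) : F.Turanable := by
  obtain ⟨t, ht, -, h⟩ := hF
  refine ⟨t, ht, fun o => ?_⟩
  obtain ⟨T, -, hT⟩ := h o
  have : (⟨0, ht⟩ : Fin t) ∈ ⋃ c ∈ T, c.verts := hT ▸ Set.mem_univ _
  simp only [Set.mem_iUnion] at this
  obtain ⟨c, -, -⟩ := this
  exact ⟨c⟩

/-! ### Obstructions from the lexicographic order -/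

/-- The edges of the complete graph ordered lexicographically, first by the smaller end. -/
theorem exists_lex_order (t : ℕ) : ∃ o : LinearOrder (SimpleGraph.completeGraph (Fin t)).edgeSet,
    ∀ e e', o.lt e e' → e.1.inf ≤ e'.1.inf := by
  let g : (SimpleGraph.completeGraph (Fin t)).edgeSet → Fin t ×ₗ Fin t :=
    fun e => toLex (e.1.inf, e.1.sup)
  have hg : Function.Injective g := by
    rintro ⟨e, he⟩ ⟨e', he'⟩ h
    simp only [g, EmbeddingLike.apply_eq_iff_eq, Prod.mk.injEq] at h
    refine Subtype.ext ?_
    induction e with | _ a b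
    induction e' with | _ c d
    simp only [Sym2.inf_mk, Sym2.sup_mk] at h
    simp only [Sym2.eq_iff]
    grind
  refine ⟨LinearOrder.lift' g hg, fun e e' h => ?_⟩
  have h : g e < g e' := h
  rcases (Prod.Lex.lt_iff).1 h with h | h
  · exact h.le
  · exact h.1.le

/-- In a universally Turánable graph, every labelling of the edges is respected by
the smaller ends of the edges, for some injective numbering of the vertices. -/
theorem _root_.UniversallyTuranable.exists_numbering {V : Type*} [Finite V] {H : SimpleGraph V}
    (hH : UniversallyTuranable H) (p : Sym2 V → ℕ) : ∃ φ : V → ℕ, Function.Injective φ ∧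
      ∀ a b c d, H.Adj a b → H.Adj c d → p s(a, b) < p s(c, d) →
        min (φ a) (φ b) ≤ min (φ c) (φ d) := by
  obtain ⟨n, ⟨q⟩⟩ := Finite.exists_equiv_fin (Sym2 V)
  -- The arbitrary numbering `q` breaks ties, so `p` need not be injective and only its strict
  -- inequalities are used.
  let g : H.edgeSet → ℕ ×ₗ Fin n := fun e => toLex (p e, q e)
  have hg : Function.Injective g := by
    intro e e' h
    simp only [g, EmbeddingLike.apply_eq_iff_eq, Prod.mk.injEq] at h
    exact Subtype.ext h.2
  obtain ⟨t, -, h⟩ := hH (LinearOrder.lift' g hg)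
  obtain ⟨o, ho⟩ := exists_lex_order t
  obtain ⟨c⟩ := h o
  refine ⟨fun v => c.toCopy v, fun u v huv => c.toCopy.injective (Fin.ext huv), ?_⟩
  intro a b a' b' hab hab' hlt
  have h₁ : (LinearOrder.lift' g hg).lt ⟨s(a, b), hab⟩ ⟨s(a', b'), hab'⟩ :=
    Prod.Lex.lt_iff.2 (.inl hlt)
  have h₂ := ho (c.toCopy.mapEdgeSet ⟨s(a, b), hab⟩) (c.toCopy.mapEdgeSet ⟨s(a', b'), hab'⟩) (by
    have hle := c.le_iff_le ⟨s(a', b'), hab'⟩ ⟨s(a, b), hab⟩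
    exact o.lt_of_not_le fun h => @not_le_of_gt _ (LinearOrder.lift' g hg).toPreorder _ _ h₁ (hle.1 h))
  have h₂ : min (c.toCopy a) (c.toCopy b) ≤ min (c.toCopy a') (c.toCopy b') := h₂
  exact_mod_cast h₂

end EdgeOrderedGraph

namespace UniversallyTuranable

variable {V : Type*} [Finite V] {H : SimpleGraph V}

/-- Order `bc < uv < cd < ab`. If `b` is the smaller end of `bc`, all four minima equal `φ b`,
although `cd` misses `b`. If `c` is, the first three equal `φ c`, although `uv` misses `c`. -/
theorem false_of_path_of_edge (hH : UniversallyTuranable H) {a b c d u v : V}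
    (hab : H.Adj a b) (hbc : H.Adj b c) (hcd : H.Adj c d) (huv : H.Adj u v)
    (hac : a ≠ c) (had : a ≠ d) (hbd : b ≠ d) (huc : u ≠ c) (hvc : v ≠ c)
    (he : s(u, v) ≠ s(a, b)) : False := by
  classical
  have nbc := hbc.ne; have ncd := hcd.ne; have nuv := huv.ne
  have nab := hab.ne
  rw [Ne, Sym2.eq_iff] at he
  obtain ⟨φ, hφ, h⟩ := hH.exists_numbering
    (fun e => if e = s(b, c) then 0 else if e = s(u, v) then 1 else if e = s(c, d) then 2 else 3)
  have h₁ := h b c u v hbc huv (by simp only [Sym2.eq_iff]; grind)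
  have h₂ := h u v c d huv hcd (by simp only [Sym2.eq_iff]; grind)
  have h₃ := h c d a b hcd hab (by simp only [Sym2.eq_iff]; grind)
  have := hφ.ne hac; have := hφ.ne had; have := hφ.ne hbd; have := hφ.ne huc; have := hφ.ne hvc
  have := hφ.ne nab; have := hφ.ne nbc; have := hφ.ne ncd; have := hφ.ne nuv
  omega

/-- Order `bc < uv < bd < cd`. If `b` is the smaller end of `bc`, then `uv` would contain `b`. If
`c` is, then `bd` would contain `c`. -/
theorem false_of_triangle_of_edge (hH : UniversallyTuranable H) {b c d u v : V}
    (hbc : H.Adj b c) (hcd : H.Adj c d) (hbd : H.Adj b d) (huv : H.Adj u v)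
    (hub : u ≠ b) (hvb : v ≠ b) (he : s(u, v) ≠ s(c, d)) : False := by
  classical
  have nbc := hbc.ne; have ncd := hcd.ne; have nuv := huv.ne
  have nbd := hbd.ne
  rw [Ne, Sym2.eq_iff] at he
  obtain ⟨φ, hφ, h⟩ := hH.exists_numbering
    (fun e => if e = s(b, c) then 0 else if e = s(u, v) then 1 else if e = s(b, d) then 2 else 3)
  have h₁ := h b c u v hbc huv (by simp only [Sym2.eq_iff]; grind)
  have h₂ := h u v b d huv hbd (by simp only [Sym2.eq_iff]; grind)
  have h₃ := h b d c d hbd hcd (by simp only [Sym2.eq_iff]; grind)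
  have := hφ.ne hub; have := hφ.ne hvb
  have := hφ.ne nbc; have := hφ.ne ncd; have := hφ.ne nbd; have := hφ.ne nuv
  omega

end UniversallyTuranable

/-! ### Isolated vertices and the structure of star forests -/

namespace SimpleGraph

theorem exists_iso_sum_bot {V : Type*} [Finite V] {k : ℕ} {H : SimpleGraph V}
    {G : SimpleGraph (Fin k)} (p : Fin k ↪ V) (h : H = G.map p) :
    ∃ m : ℕ, Nonempty (H ≃g SimpleGraph.sum G (⊥ : SimpleGraph (Fin m))) := by
  classical
  obtain ⟨m, ⟨q⟩⟩ := Finite.exists_equiv_fin ((Set.range p)ᶜ : Set V)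
  let e : Fin k ⊕ Fin m ≃ V := ((Equiv.ofInjective p p.injective).sumCongr q.symm).trans
    (Equiv.Set.sumCompl (Set.range p))
  have hl : ∀ i, e (.inl i) = p i := fun i => rfl
  have hr : ∀ i, e (.inr i) ∉ Set.range p := fun i => (q.symm i).2
  refine ⟨m, ⟨Iso.symm ⟨e, @fun x y => ?_⟩⟩⟩
  subst h
  rcases x with x | x <;> rcases y with y | y
  · rw [hl, hl]
    exact map_adj_apply
  · simp only [map_adj, SimpleGraph.sum]
    refine ⟨fun ⟨u, v, _, _, h⟩ => (hr y ⟨v, h⟩).elim, by simp⟩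
  · simp only [map_adj, SimpleGraph.sum]
    refine ⟨fun ⟨u, v, _, h, _⟩ => (hr x ⟨u, h⟩).elim, by simp⟩
  · simp only [map_adj, SimpleGraph.sum]
    refine ⟨fun ⟨u, v, _, h, _⟩ => (hr x ⟨u, h⟩).elim, by simp⟩

theorem exists_eq_map_of_iso_sum_bot {V : Type*} {k m : ℕ} {H : SimpleGraph V}
    {G : SimpleGraph (Fin k)} (e : H ≃g SimpleGraph.sum G (⊥ : SimpleGraph (Fin m))) :
    ∃ p : Fin k ↪ V, H = G.map p := by
  refine ⟨Function.Embedding.inl.trans e.symm.toEquiv.toEmbedding, ?_⟩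
  ext u v
  rw [← e.map_adj_iff, map_adj]
  simp only [Function.Embedding.trans_apply, Equiv.coe_toEmbedding, RelIso.coe_fn_toEquiv,
    Function.Embedding.inl_apply]
  constructor
  · intro h
    rcases hu : e u with x | x <;> rcases hv : e v with y | y <;> rw [hu, hv] at h <;>
      simp [SimpleGraph.sum] at h
    exact ⟨x, y, h, by simp [← hu], by simp [← hv]⟩
  · rintro ⟨x, y, h, rfl, rfl⟩
    rwa [e.apply_symm_apply, e.apply_symm_apply]

theorem map_pathGraph_four_adj {V : Type*} (p : Fin 4 ↪ V) (u v : V) :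
    ((pathGraph 4).map p).Adj u v ↔
      s(u, v) = s(p 0, p 1) ∨ s(u, v) = s(p 1, p 2) ∨ s(u, v) = s(p 2, p 3) := by
  simp only [map_adj, pathGraph_adj, Fin.exists_fin_succ, Sym2.eq_iff]
  simp
  grind

theorem map_complete_three_adj {V : Type*} (p : Fin 3 ↪ V) (u v : V) :
    ((completeGraph (Fin 3)).map p).Adj u v ↔
      s(u, v) = s(p 0, p 1) ∨ s(u, v) = s(p 0, p 2) ∨ s(u, v) = s(p 1, p 2) := by
  simp only [map_adj, top_adj, Fin.exists_fin_succ, Sym2.eq_iff]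
  simp
  grind

/-- Take any vertex of the component, or its neighbour if it has exactly one, as the centre `r`. A
vertex at distance two from `r` would extend to a three-edge path through a second neighbour of `r`,
so all vertices are within distance one. Without triangles, no two neighbours of `r` are adjacent.
-/
theorem isStarForest_of_forall {V : Type*} {H : SimpleGraph V}
    (htri : ∀ a b c, H.Adj a b → H.Adj b c → H.Adj a c → False)
    (hpath : ∀ a b c d, H.Adj a b → H.Adj b c → H.Adj c d → a ≠ c → a ≠ d → b ≠ d → False) :
    IsStarForest H := by
  intro C
  obtain ⟨r, hrC, hr⟩ : ∃ r ∈ C, ∀ w w', H.Adj r w → H.Adj w w' →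
      w' = r ∨ ∃ z, z ≠ w ∧ H.Adj r z := by
    obtain ⟨v, rfl⟩ := C.exists_rep
    by_cases hv : ∃ u, H.Adj v u ∧ ∀ z, H.Adj v z → z = u
    · obtain ⟨u, hvu, hu⟩ := hv
      refine ⟨u, ConnectedComponent.sound hvu.symm.reachable, fun w w' h h' => ?_⟩
      by_cases hw : v = w
      · exact .inl (hu w' (hw ▸ h'))
      · exact .inr ⟨v, hw, hvu.symm⟩
    · push Not at hv
      refine ⟨v, rfl, fun w w' h _ => ?_⟩
      obtain ⟨z, hz, hne⟩ := hv w h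
      exact .inr ⟨z, hne, hz⟩
  have hreach : ∀ w, H.Reachable r w → w = r ∨ H.Adj r w := by
    intro w hw
    rw [reachable_iff_reflTransGen] at hw
    induction hw with
    | refl => exact .inl rfl
    | tail _ hwy ih =>
      rename_i w y _
      rcases ih with rfl | ih
      · exact .inr hwy
      rcases hr w y ih hwy with h | ⟨z, hzw, hz⟩
      · exact .inl h
      · by_contra! hy
        exact hpath y w r z hwy.symm ih.symm hz hy.1 (fun h => hy.2 (h ▸ hz)) hzw.symm
  have hmem : ∀ w ∈ C, H.Reachable r w := fun w hw => ConnectedComponent.exact (hrC.trans hw.symm)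
  refine ⟨⟨r, hrC⟩, ?_⟩
  ext ⟨x, hx⟩ ⟨y, hy⟩
  simp only [ConnectedComponent.toSimpleGraph, comap_adj, Function.Embedding.subtype_apply,
    starGraph_adj, ne_eq, Subtype.mk.injEq]
  have h₁ := hreach x (hmem x hx)
  have h₂ := hreach y (hmem y hy)
  constructor
  · intro h
    refine ⟨h.ne, ?_⟩
    by_contra! hne
    exact htri r x y (h₁.resolve_left hne.1) h (h₂.resolve_left hne.2)
  · rintro ⟨hne, rfl | rfl⟩
    · exact h₂.resolve_left (Ne.symm hne)
    · exact (h₁.resolve_left hne).symm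

/-- In a star forest, every vertex can be assigned a centre in such a way that
the edges are the pairs consisting of a vertex and its centre. -/
theorem _root_.IsStarForest.exists_centre {V : Type*} {H : SimpleGraph V} (h : IsStarForest H) :
    ∃ r : V → V, (∀ v, r (r v) = r v) ∧
      ∀ u v, H.Adj u v ↔ u ≠ v ∧ (r u = v ∨ r v = u) := by
  choose r hr using h
  have hadj : ∀ (C : H.ConnectedComponent) (u v : C), H.Adj u v ↔ u ≠ v ∧ (u = r C ∨ v = r C) := by
    intro C u v
    rw [← starGraph_adj, ← hr C]
    rfl
  have hC : ∀ C : H.ConnectedComponent, H.connectedComponentMk (r C) = C := fun C => (r C).2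
  refine ⟨fun v => r (H.connectedComponentMk v), fun v => congrArg (fun C => (r C : V)) (hC _), fun u v => ?_⟩
  beta_reduce
  constructor
  · intro huv
    refine ⟨huv.ne, ?_⟩
    have he : H.connectedComponentMk v = H.connectedComponentMk u :=
      ConnectedComponent.sound huv.symm.reachable
    have := (hadj (H.connectedComponentMk u) ⟨u, rfl⟩ ⟨v, he⟩).1 huv
    rw [he]
    rcases this.2 with h | h
    · exact .inr (congrArg Subtype.val h).symm
    · exact .inl (congrArg Subtype.val h).symm
  · have key : ∀ u : V, u ≠ r (H.connectedComponentMk u) → 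
        H.Adj u (r (H.connectedComponentMk u)) := fun u hu =>
      (hadj (H.connectedComponentMk u) ⟨u, rfl⟩ (r _)).2
        ⟨fun h => hu (congrArg Subtype.val h), .inr rfl⟩
    rintro ⟨hne, h | h⟩
    · have := key u (by rw [h]; exact hne)
      rwa [h] at this
    · have := key v (by rw [h]; exact hne.symm)
      rw [h] at this
      exact this.symm

end SimpleGraph

/-! ### Classification of universally Turánable graphs -/

theorem UniversallyTuranable.isStarForest_or {V : Type*} [Finite V] {H : SimpleGraph V}
    (hH : UniversallyTuranable H) :
    IsStarForest H ∨ IsThreeEdgePathWithIsolated H ∨ IsTriangleWithIsolated H := by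
  by_cases htri : ∃ b c d, H.Adj b c ∧ H.Adj c d ∧ H.Adj b d
  · obtain ⟨b, c, d, hbc, hcd, hbd⟩ := htri
    have nbc := hbc.ne; have ncd := hcd.ne; have nbd := hbd.ne
    refine .inr (.inr ?_)
    have hinj : Function.Injective ![b, c, d] := by
      simp [Function.Injective, Fin.forall_fin_succ, *, Ne.symm]
    refine SimpleGraph.exists_iso_sum_bot ⟨![b, c, d], hinj⟩ ?_
    · ext u v
      rw [SimpleGraph.map_complete_three_adj]
      simp only [Function.Embedding.coeFn_mk, Matrix.cons_val]
      constructor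
      · intro huv
        by_contra! hne
        have := huv.ne
        -- A fourth edge would have to contain all of `b`, `c`, `d`.
        have h₁ : ¬ (u ≠ b ∧ v ≠ b) := fun h =>
          hH.false_of_triangle_of_edge hbc hcd hbd huv h.1 h.2 hne.2.2
        have h₂ : ¬ (u ≠ c ∧ v ≠ c) := fun h =>
          hH.false_of_triangle_of_edge hbc.symm hbd hcd huv h.1 h.2 hne.2.1
        have h₃ : ¬ (u ≠ d ∧ v ≠ d) := fun h =>
          hH.false_of_triangle_of_edge hbd.symm hbc hcd.symm huv h.1 h.2 hne.1
        grind
      · simp only [Sym2.eq_iff]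
        rintro ((⟨rfl, rfl⟩ | ⟨rfl, rfl⟩) | (⟨rfl, rfl⟩ | ⟨rfl, rfl⟩) | (⟨rfl, rfl⟩ | ⟨rfl, rfl⟩))
          <;> first | assumption | exact SimpleGraph.Adj.symm ‹_›
  by_cases hpath : ∃ a b c d, H.Adj a b ∧ H.Adj b c ∧ H.Adj c d ∧ a ≠ c ∧ a ≠ d ∧ b ≠ d
  · obtain ⟨a, b, c, d, hab, hbc, hcd, hac, had, hbd⟩ := hpath
    have nab := hab.ne; have nbc := hbc.ne; have ncd := hcd.ne
    refine .inr (.inl ?_)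
    have hinj : Function.Injective ![a, b, c, d] := by
      simp [Function.Injective, Fin.forall_fin_succ, *, Ne.symm]
    refine SimpleGraph.exists_iso_sum_bot ⟨![a, b, c, d], hinj⟩ ?_
    · ext u v
      rw [SimpleGraph.map_pathGraph_four_adj]
      simp only [Function.Embedding.coeFn_mk, Matrix.cons_val]
      constructor
      · intro huv
        by_contra! hne
        have := huv.ne
        -- A further edge would contain `c` and, by reversing the path, `b`; so it would be `bc`.
        have h₁ : ¬ (u ≠ c ∧ v ≠ c) := fun h =>
          hH.false_of_path_of_edge hab hbc hcd huv hac had hbd h.1 h.2 hne.1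
        have h₂ : ¬ (u ≠ b ∧ v ≠ b) := fun h =>
          hH.false_of_path_of_edge hcd.symm hbc.symm hab.symm huv hbd.symm had.symm hac.symm
            h.1 h.2 (by rw [Sym2.eq_swap (a := d)]; exact hne.2.2)
        grind
      · simp only [Sym2.eq_iff]
        rintro ((⟨rfl, rfl⟩ | ⟨rfl, rfl⟩) | (⟨rfl, rfl⟩ | ⟨rfl, rfl⟩) | (⟨rfl, rfl⟩ | ⟨rfl, rfl⟩))
          <;> first | assumption | exact SimpleGraph.Adj.symm ‹_›
  refine .inl (SimpleGraph.isStarForest_of_forall (fun a b c h₁ h₂ h₃ => htri ⟨a, b, c, h₁, h₂, h₃⟩)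
    fun a b c d h₁ h₂ h₃ h₄ h₅ h₆ => hpath ⟨a, b, c, d, h₁, h₂, h₃, h₄, h₅, h₆⟩)

/-! ### Reduction to the non-isolated vertices -/

namespace EdgeOrderedGraph

theorem label_ne {V : Type*} {F : EdgeOrderedGraph V} {W : Sym2 V → ℕ}
    (hW : ∀ e e' : F.graph.edgeSet, W e < W e' ↔ F.order.lt e e') {e e' : Sym2 V}
    (he : e ∈ F.graph.edgeSet) (he' : e' ∈ F.graph.edgeSet) (hne : e ≠ e') : W e ≠ W e' := by
  intro h
  refine hne (congrArg Subtype.val (F.order.eq_of_not_lt (a := ⟨e, he⟩) (b := ⟨e', he'⟩) ?_ ?_))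
  · rw [← hW]; exact h.not_lt
  · rw [← hW]; exact h.not_gt

theorem _root_.Function.Embedding.exists_extend_finset {V α : Type*} [Fintype V]
    {k : ℕ} (p : Fin k ↪ V) (g : Fin k ↪ α) (S : Finset α) (hg : ∀ i, g i ∈ S)
    (hS : Fintype.card V ≤ S.card) :
    ∃ φ : V → α, Function.Injective φ ∧ (∀ v, φ v ∈ S) ∧ ∀ i, φ (p i) = g i := by
  classical
  obtain ⟨T, hT, hTS, hTc⟩ := Finset.exists_subsuperset_card_eq (s := Finset.univ.image g)
    (t := S) (n := Fintype.card V) (by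
      intro y hy
      obtain ⟨i, -, rfl⟩ := Finset.mem_image.1 hy
      exact hg i) (by
      rw [Finset.card_image_of_injective _ g.injective, Finset.card_univ]
      exact Fintype.card_le_of_embedding p) hS
  rcases isEmpty_or_nonempty (Fin k) with hk | ⟨⟨i₀⟩⟩
  · obtain ⟨e⟩ := Fintype.card_eq.1 (hTc.symm.trans (Fintype.card_coe T).symm)
    exact ⟨fun v => e v, fun u v h => e.injective (Subtype.ext h), fun v => hTS (e v).2,
      fun i => hk.elim i⟩
  have hext : ∀ i, Function.extend p g (fun _ => g i₀) (p i) = g i :=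
    fun i => p.injective.extend_apply _ _ _
  obtain ⟨e, he⟩ := Finset.exists_equiv_extend_of_card_eq hTc.symm (s := Finset.univ.image p)
    (f := Function.extend p g fun _ => g i₀) (by
      intro y hy
      simp only [Finset.mem_image, Finset.mem_univ, true_and, exists_exists_eq_and, hext] at hy
      obtain ⟨i, rfl⟩ := hy
      exact hT (Finset.mem_image_of_mem _ (Finset.mem_univ i))) (by
      intro u hu v hv h
      simp only [Finset.coe_image, Finset.coe_univ, Set.image_univ, Set.mem_range] at hu hv
      obtain ⟨i, rfl⟩ := hu
      obtain ⟨j, rfl⟩ := hv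
      rw [hext, hext] at h
      rw [g.injective h])
  refine ⟨fun v => e v, fun u v h => e.injective (Subtype.ext h), fun v => hTS (e v).2,
    fun i => ?_⟩
  beta_reduce
  rw [he _ (Finset.mem_image_of_mem _ (Finset.mem_univ i)), hext]

/-- Vertices outside the range of `p` are isolated and impose no order condition, so they fill spare
places of `S` once the core has been placed through `x`. -/
theorem CoversVertices.of_eq_map {V : Type*} [Fintype V] {k : ℕ} {G : SimpleGraph (Fin k)}
    {F : EdgeOrderedGraph V} {W : Sym2 V → ℕ}
    (hW : ∀ e e' : F.graph.edgeSet, W e < W e' ↔ F.order.lt e e')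
    (p : Fin k ↪ V) (hp : F.graph = G.map p) (n : ℕ)
    (h : ∀ (t : ℕ) (w : Sym2 (Fin t) → ℤ), Set.InjOn w {e | ¬ e.IsDiag} →
      ∀ (S : Finset (Fin t)) (x : Fin t), x ∈ S → n ≤ S.card →
      ∃ g : Fin k ↪ Fin t, (∀ i, g i ∈ S) ∧ (∃ i, g i = x) ∧
        ∀ e ∈ G.edgeSet, ∀ e' ∈ G.edgeSet, W (e.map p) < W (e'.map p) →
          w (e.map g) < w (e'.map g)) : F.CoversVertices := by
  refine ⟨max n (Fintype.card V), fun t w hw S x hx hS => ?_⟩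
  obtain ⟨g, hgS, ⟨i, hi⟩, hg⟩ := h t w hw S x hx ((le_max_left _ _).trans hS)
  obtain ⟨φ, hφ, hφS, hφg⟩ := p.exists_extend_finset g S hgS ((le_max_right _ _).trans hS)
  have hcomp : φ ∘ p = g := funext hφg
  refine ⟨φ, hφ, hφS, ⟨p i, (hφg i).trans hi⟩, ?_⟩
  have hedge : ∀ e : F.graph.edgeSet, ∃ e₀ ∈ G.edgeSet, e₀.map p = e.1 := by
    rintro ⟨e, he⟩
    induction e with | _ u v
    rw [hp] at he
    obtain ⟨a, b, hab, rfl, rfl⟩ := (SimpleGraph.map_adj p G u v).1 he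
    exact ⟨s(a, b), hab, rfl⟩
  intro e e' hee
  obtain ⟨e₀, h₀, he₀⟩ := hedge e
  obtain ⟨e₀', h₀', he₀'⟩ := hedge e'
  rw [← hW, ← he₀, ← he₀'] at hee
  have := hg e₀ h₀ e₀' h₀' hee
  rwa [← he₀, ← he₀', Sym2.map_map, Sym2.map_map, hcomp]

/-! ### Covering by triangles -/

section Triangle

/-- Let `a` be the common end of the two lightest edges and `c` that of the two heaviest. Hence all
edge orders of a triangle are isomorphic. -/
theorem exists_sorted_triangle {α γ : Type*} [LinearOrder γ] (w : Sym2 α → γ) {x y z : α}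
    (h₁ : w s(x, y) ≠ w s(x, z)) (h₂ : w s(x, y) ≠ w s(y, z)) (h₃ : w s(x, z) ≠ w s(y, z)) :
    ∃ a b c, ({a, b, c} : Set α) = {x, y, z} ∧ w s(a, b) < w s(a, c) ∧ w s(a, c) < w s(b, c) := by
  have swap : ∀ a b : α, s(a, b) = s(b, a) := fun a b => Sym2.eq_swap
  rcases lt_or_gt_of_ne h₁ with h₁ | h₁ <;> rcases lt_or_gt_of_ne h₂ with h₂ | h₂ <;>
    rcases lt_or_gt_of_ne h₃ with h₃ | h₃
  · exact ⟨x, y, z, rfl, h₁, h₃⟩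
  · exact ⟨y, x, z, by grind, by rwa [swap y x], h₃⟩
  · exact absurd (h₁.trans h₃) h₂.not_gt
  · exact ⟨y, z, x, by grind, by rwa [swap y x], by rwa [swap y x, swap z x]⟩
  · exact ⟨x, z, y, by grind, h₁, by rwa [swap z y]⟩
  · exact absurd (h₃.trans h₁) h₂.not_gt
  · exact ⟨z, x, y, by grind, by rwa [swap z x, swap z y], by rwa [swap z y]⟩
  · exact ⟨z, y, x, by grind, by rwa [swap z x, swap z y], by rwa [swap z x, swap y x]⟩

theorem CoversVertices.of_triangle {V : Type*} [Fintype V] (F : EdgeOrderedGraph V)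
    (p : Fin 3 ↪ V) (hp : F.graph = (SimpleGraph.completeGraph (Fin 3)).map p) :
    F.CoversVertices := by
  classical
  obtain ⟨W, hW⟩ := F.exists_label
  have hadj := SimpleGraph.map_complete_three_adj p
  rw [← hp] at hadj
  have n₁ : p 0 ≠ p 1 := p.injective.ne (by decide)
  have n₂ : p 0 ≠ p 2 := p.injective.ne (by decide)
  have n₃ : p 1 ≠ p 2 := p.injective.ne (by decide)
  have m₁ : s(p 0, p 1) ∈ F.graph.edgeSet := (hadj _ _).2 (by simp)
  have m₂ : s(p 0, p 2) ∈ F.graph.edgeSet := (hadj _ _).2 (by simp)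
  have m₃ : s(p 1, p 2) ∈ F.graph.edgeSet := (hadj _ _).2 (by simp)
  obtain ⟨a, b, c, habc, h₁, h₂⟩ := exists_sorted_triangle W (x := p 0) (y := p 1) (z := p 2)
    (label_ne hW m₁ m₂ (by simp only [ne_eq, Sym2.eq_iff]; grind))
    (label_ne hW m₁ m₃ (by simp only [ne_eq, Sym2.eq_iff]; grind))
    (label_ne hW m₂ m₃ (by simp only [ne_eq, Sym2.eq_iff]; grind))
  have hset : ∀ y, (y = a ∨ y = b ∨ y = c) ↔ (y = p 0 ∨ y = p 1 ∨ y = p 2) := fun y => by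
    simpa using Set.ext_iff.1 habc y
  have nab : a ≠ b := by rintro rfl; grind
  have nac : a ≠ c := by rintro rfl; grind
  have nbc : b ≠ c := by rintro rfl; grind
  have hinj : Function.Injective ![a, b, c] := by
    simp [Function.Injective, Fin.forall_fin_succ, *, Ne.symm]
  refine .of_eq_map (G := SimpleGraph.completeGraph (Fin 3)) hW ⟨![a, b, c], hinj⟩ ?_ 3 ?_
  · ext u v
    rw [hadj, SimpleGraph.map_complete_three_adj]
    simp only [Function.Embedding.coeFn_mk, Matrix.cons_val, Sym2.eq_iff]
    have := hset a; have := hset b; have := hset c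
    grind
  intro t w hw S x hx hS
  obtain ⟨y, hy, z, hz, hyz⟩ := Finset.one_lt_card.1 (show 1 < (S.erase x).card by
    rw [Finset.card_erase_of_mem hx]; omega)
  rw [Finset.mem_erase] at hy hz
  obtain ⟨a', b', c', habc', h₁', h₂'⟩ := exists_sorted_triangle w (x := x) (y := y) (z := z)
    (hw.ne (by simp; grind) (by simp; grind) (by simp only [ne_eq, Sym2.eq_iff]; grind))
    (hw.ne (by simp; grind) (by simp; grind) (by simp only [ne_eq, Sym2.eq_iff]; grind))
    (hw.ne (by simp; grind) (by simp; grind) (by simp only [ne_eq, Sym2.eq_iff]; grind))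
  have hset' : ∀ v, (v = a' ∨ v = b' ∨ v = c') ↔ (v = x ∨ v = y ∨ v = z) := fun v => by
    simpa using Set.ext_iff.1 habc' v
  have nab' : a' ≠ b' := by rintro rfl; grind
  have nac' : a' ≠ c' := by rintro rfl; grind
  have nbc' : b' ≠ c' := by rintro rfl; grind
  have hinj' : Function.Injective ![a', b', c'] := by
    simp [Function.Injective, Fin.forall_fin_succ, *, Ne.symm]
  refine ⟨⟨![a', b', c'], hinj'⟩, ?_, ?_, ?_⟩
  · have := hset' a'; have := hset' b'; have := hset' c'
    simp only [Function.Embedding.coeFn_mk, Fin.forall_fin_succ]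
    simp
    grind
  · have := hset' x
    simp only [Function.Embedding.coeFn_mk, Fin.exists_fin_succ]
    simp
    grind
  · have hE : ∀ e ∈ (SimpleGraph.completeGraph (Fin 3)).edgeSet,
        e = s(0, 1) ∨ e = s(0, 2) ∨ e = s(1, 2) := by
      intro e
      induction e with | _ u v
      simp only [SimpleGraph.mem_edgeSet, SimpleGraph.top_adj]
      revert u v
      decide
    intro e he e' he'
    rcases hE e he with rfl | rfl | rfl <;> rcases hE e' he' with rfl | rfl | rfl <;>
      simp only [Sym2.map_mk, Function.Embedding.coeFn_mk, Matrix.cons_val] <;> intros <;>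
      first | assumption | (exact h₁'.trans h₂') | omega

end Triangle

/-! ### Covering by three-edge paths -/

section Path

variable {α : Type*} {w : Sym2 α → ℤ} {S : Finset α} {x : α}

/-- `a`, `b`, `c`, `d` are distinct elements of `S`, one of which is `x`. -/
structure IsPathThrough (S : Finset α) (x a b c d : α) : Prop where
  injective : Function.Injective ![a, b, c, d]
  mem : ∀ i, ![a, b, c, d] i ∈ S
  through : ∃ i, ![a, b, c, d] i = x

theorem IsPathThrough.intro {a b c d : α} (ha : a ∈ S) (hb : b ∈ S) (hc : c ∈ S) (hd : d ∈ S)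
    (hab : a ≠ b) (hac : a ≠ c) (had : a ≠ d) (hbc : b ≠ c) (hbd : b ≠ d) (hcd : c ≠ d)
    (hx : x = a ∨ x = b ∨ x = c ∨ x = d) : IsPathThrough S x a b c d := by
  refine ⟨?_, ?_, ?_⟩
  · simp [Function.Injective, Fin.forall_fin_succ, *, Ne.symm]
  · simp [Fin.forall_fin_succ, *]
  · simp only [Fin.exists_fin_succ]
    simp
    grind

/-- In a 4-set containing `x`, put the lightest edge in the middle. The path spans the 4-set, so it
meets `x`, and its direction is free. -/
theorem exists_path_middle_lt (hw : Set.InjOn w {e | ¬ e.IsDiag}) (hx : x ∈ S) (hS : 4 ≤ S.card) :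
    ∃ a b c d, IsPathThrough S x a b c d ∧ w s(b, c) < w s(a, b) ∧ w s(a, b) < w s(c, d) := by
  classical
  obtain ⟨T, hxT, hTS, hT⟩ := Finset.exists_subsuperset_card_eq (s := {x}) (t := S) (n := 4)
    (by simpa) (by simp) hS
  have hxT : x ∈ T := by simpa using hxT
  obtain ⟨⟨b, c⟩, hbc, hmin⟩ := Finset.exists_min_image T.offDiag (fun q => w s(q.1, q.2)) (by
    obtain ⟨u, hu, v, hv, huv⟩ := Finset.one_lt_card.1 (show 1 < T.card by omega)
    exact ⟨(u, v), Finset.mem_offDiag.2 ⟨hu, hv, huv⟩⟩)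
  obtain ⟨hb, hc, hne⟩ := Finset.mem_offDiag.1 hbc
  obtain ⟨a, d, had, hTad⟩ := Finset.card_eq_two.1 (show ((T.erase b).erase c).card = 2 by
    rw [Finset.card_erase_of_mem (by simp [hc, Ne.symm hne]), Finset.card_erase_of_mem hb, hT])
  have hmem : ∀ y, (y ≠ c ∧ y ≠ b ∧ y ∈ T) ↔ (y = a ∨ y = d) := fun y => by
    simpa using Finset.ext_iff.1 hTad y
  have ha := (hmem a).2 (.inl rfl)
  have hd := (hmem d).2 (.inr rfl)
  have hx' := hmem x
  have hlt : ∀ u v, u ∈ T → v ∈ T → u ≠ v → s(b, c) ≠ s(u, v) → w s(b, c) < w s(u, v) := by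
    intro u v hu hv huv h
    exact lt_of_le_of_ne (hmin (u, v) (Finset.mem_offDiag.2 ⟨hu, hv, huv⟩))
      (hw.ne (by simpa using hne) (by simpa using huv) h)
  have h₁ := hlt a b ha.2.2 hb ha.2.1 (by simp only [ne_eq, Sym2.eq_iff]; grind)
  have h₂ := hlt c d hc hd.2.2 hd.1.symm (by simp only [ne_eq, Sym2.eq_iff]; grind)
  have h₃ : w s(a, b) ≠ w s(c, d) := hw.ne (by simpa using ha.2.1) (by simpa using hd.1.symm)
    (by simp only [ne_eq, Sym2.eq_iff]; grind)
  rcases lt_or_gt_of_ne h₃ with h | h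
  · exact ⟨a, b, c, d, .intro (hTS ha.2.2) (hTS hb) (hTS hc) (hTS hd.2.2) ha.2.1 ha.1 had hne
      hd.2.1.symm hd.1.symm (by grind), h₁, h⟩
  · refine ⟨d, c, b, a, .intro (hTS hd.2.2) (hTS hc) (hTS hb) (hTS ha.2.2) hd.1 hd.2.1 had.symm
      hne.symm ha.1.symm ha.2.1.symm (by grind), ?_, ?_⟩
    · rwa [Sym2.eq_swap (a := c), Sym2.eq_swap (a := d)]
    · rwa [Sym2.eq_swap (a := d), Sym2.eq_swap (a := b)]

/-- Negating the labels reverses the order; integer labels allow this. -/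
theorem exists_path_lt_middle (hw : Set.InjOn w {e | ¬ e.IsDiag}) (hx : x ∈ S) (hS : 4 ≤ S.card) :
    ∃ a b c d, IsPathThrough S x a b c d ∧ w s(a, b) < w s(c, d) ∧ w s(c, d) < w s(b, c) := by
  obtain ⟨a, b, c, d, h, h₁, h₂⟩ := exists_path_middle_lt (w := fun e => -w e)
    (fun e he e' he' h => hw he he' (neg_injective h)) hx hS
  have h₃ := h.injective
  have h₄ := h.mem
  obtain ⟨i, hi⟩ := h.through
  simp only [Function.Injective, Fin.forall_fin_succ] at h₃ h₄
  simp at h₃ h₄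
  refine ⟨d, c, b, a, .intro ?_ ?_ ?_ ?_ ?_ ?_ ?_ ?_ ?_ ?_ ?_, ?_, ?_⟩
  iterate 10 grind
  · fin_cases i <;> simp at hi <;> simp [hi]
  · rw [Sym2.eq_swap (a := d), Sym2.eq_swap (a := b)]
    exact neg_lt_neg_iff.1 h₂
  · rw [Sym2.eq_swap (a := c), Sym2.eq_swap (a := b) (b := a)]
    exact neg_lt_neg_iff.1 h₁

/-- Let `xa` and `xb` be the lightest and heaviest edges at `x`, and `d`, `e` two more vertices. If
`xd < de`, the path `a x d e` increases; otherwise `e d x b` does. -/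
theorem exists_path_monotone (hw : Set.InjOn w {e | ¬ e.IsDiag}) (hx : x ∈ S) (hS : 5 ≤ S.card) :
    ∃ a b c d, IsPathThrough S x a b c d ∧ w s(a, b) < w s(b, c) ∧ w s(b, c) < w s(c, d) := by
  classical
  have hc₁ : 4 ≤ (S.erase x).card := by rw [Finset.card_erase_of_mem hx]; omega
  have hne : (S.erase x).Nonempty := Finset.card_pos.1 (by omega)
  obtain ⟨a, ha, hmin⟩ := Finset.exists_min_image (S.erase x) (fun y => w s(x, y)) hne
  obtain ⟨b, hb, hmax⟩ := Finset.exists_max_image (S.erase x) (fun y => w s(x, y)) hne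
  obtain ⟨d, hd, e, he, hde⟩ := Finset.one_lt_card.1
    (show 1 < (((S.erase x).erase a).erase b).card by
      have := Finset.pred_card_le_card_erase (s := S.erase x) (a := a)
      have := Finset.pred_card_le_card_erase (s := (S.erase x).erase a) (a := b)
      omega)
  have hmin := hmin d
  have hmax := hmax d
  simp only [Finset.mem_erase] at ha hb hd he hmin hmax
  have hinj : ∀ u v u' v', u ≠ v → u' ≠ v' → s(u, v) ≠ s(u', v') → w s(u, v) ≠ w s(u', v') :=
    fun u v u' v' h h' hn => hw.ne (by simpa using h) (by simpa using h') hn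
  have h₁ : w s(x, a) < w s(x, d) := lt_of_le_of_ne (hmin hd.2.2)
    (hinj _ _ _ _ (Ne.symm ha.1) (Ne.symm hd.2.2.1) (by simp only [ne_eq, Sym2.eq_iff]; grind))
  have h₂ : w s(x, d) < w s(x, b) := lt_of_le_of_ne (hmax hd.2.2)
    (hinj _ _ _ _ (Ne.symm hd.2.2.1) (Ne.symm hb.1) (by simp only [ne_eq, Sym2.eq_iff]; grind))
  have h₃ : w s(x, d) ≠ w s(d, e) :=
    hinj _ _ _ _ (Ne.symm hd.2.2.1) hde (by simp only [ne_eq, Sym2.eq_iff]; grind)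
  rcases lt_or_gt_of_ne h₃ with h | h
  · exact ⟨a, x, d, e, .intro ha.2 hx hd.2.2.2 he.2.2.2 ha.1 (Ne.symm hd.2.1) (Ne.symm he.2.1)
      (Ne.symm hd.2.2.1) (Ne.symm he.2.2.1) hde (by simp), by rwa [Sym2.eq_swap (a := a)], h⟩
  · exact ⟨e, d, x, b, .intro he.2.2.2 hd.2.2.2 hx hb.2 hde.symm he.2.2.1 he.1 hd.2.2.1 hd.1
      (Ne.symm hb.1) (by simp), by rwa [Sym2.eq_swap (a := e), Sym2.eq_swap (a := d) (b := x)],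
      by rwa [Sym2.eq_swap (a := d)]⟩

theorem CoversVertices.of_path {V : Type*} [Fintype V] (F : EdgeOrderedGraph V)
    (p : Fin 4 ↪ V) (hp : F.graph = (SimpleGraph.pathGraph 4).map p) : F.CoversVertices := by
  classical
  obtain ⟨W, hW⟩ := F.exists_label
  have hE : ∀ e ∈ (SimpleGraph.pathGraph 4).edgeSet, e = s(0, 1) ∨ e = s(1, 2) ∨ e = s(2, 3) := by
    intro e
    induction e with | _ u v
    simp only [SimpleGraph.mem_edgeSet, SimpleGraph.pathGraph_adj]
    revert u v
    decide
  have hne : ∀ i j k l : Fin 4, (SimpleGraph.pathGraph 4).Adj i j →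
      (SimpleGraph.pathGraph 4).Adj k l → s(i, j) ≠ s(k, l) →
      W s(p i, p j) ≠ W s(p k, p l) := by
    intro i j k l h h' hn
    refine label_ne hW ?_ ?_ fun h => hn (Sym2.map.injective p.injective h)
    · rw [hp]; exact SimpleGraph.map_adj_apply.2 h
    · rw [hp]; exact SimpleGraph.map_adj_apply.2 h'
  have n₁₂ := hne 0 1 1 2 (by simp [SimpleGraph.pathGraph_adj])
    (by simp [SimpleGraph.pathGraph_adj]) (by decide)
  have n₁₃ := hne 0 1 2 3 (by simp [SimpleGraph.pathGraph_adj])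
    (by simp [SimpleGraph.pathGraph_adj]) (by decide)
  have n₂₃ := hne 1 2 2 3 (by simp [SimpleGraph.pathGraph_adj])
    (by simp [SimpleGraph.pathGraph_adj]) (by decide)
  clear hne
  -- Reversing the path swaps its end edges, leaving three orders, according to the rank of the
  -- middle edge.
  wlog h₁₃ : W s(p 0, p 1) < W s(p 2, p 3) generalizing p
  · have h₀ : Fin.rev (0 : Fin 4) = 3 := rfl
    have h₁ : Fin.rev (1 : Fin 4) = 2 := rfl
    have h₂ : Fin.rev (2 : Fin 4) = 1 := rfl
    have h₃ : Fin.rev (3 : Fin 4) = 0 := rfl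
    have swap : ∀ a b : V, s(a, b) = s(b, a) := fun a b => Sym2.eq_swap
    refine this (Fin.revPerm.toEmbedding.trans p) ?_ ?_ ?_ ?_ ?_
    · ext u v
      rw [hp, SimpleGraph.map_pathGraph_four_adj, SimpleGraph.map_pathGraph_four_adj]
      simp only [Function.Embedding.trans_apply, Equiv.coe_toEmbedding, Fin.revPerm_apply,
        h₀, h₁, h₂, h₃, swap (p 3), swap (p 2) (p 1), swap (p 1) (p 0)]
      tauto
    all_goals
      simp only [Function.Embedding.trans_apply, Equiv.coe_toEmbedding, Fin.revPerm_apply,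
        h₀, h₁, h₂, h₃, swap (p 3), swap (p 2) (p 1), swap (p 1) (p 0)]
      omega
  refine .of_eq_map hW p hp 5 fun t w hw S x hx hS => ?_
  have fin : ∀ a b c d : Fin t, IsPathThrough S x a b c d →
      (∀ e ∈ (SimpleGraph.pathGraph 4).edgeSet, ∀ e' ∈ (SimpleGraph.pathGraph 4).edgeSet,
        W (e.map p) < W (e'.map p) → w (e.map ![a, b, c, d]) < w (e'.map ![a, b, c, d])) →
      ∃ g : Fin 4 ↪ Fin t, (∀ i, g i ∈ S) ∧ (∃ i, g i = x) ∧
        ∀ e ∈ (SimpleGraph.pathGraph 4).edgeSet, ∀ e' ∈ (SimpleGraph.pathGraph 4).edgeSet,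
          W (e.map p) < W (e'.map p) → w (e.map g) < w (e'.map g) :=
    fun a b c d h h' => ⟨⟨_, h.injective⟩, h.mem, h.through, h'⟩
  have fin' : ∀ {a b c d : Fin t}, IsPathThrough S x a b c d →
      (W s(p 0, p 1) < W s(p 1, p 2) → w s(a, b) < w s(b, c)) →
      (W s(p 1, p 2) < W s(p 0, p 1) → w s(b, c) < w s(a, b)) →
      (W s(p 2, p 3) < W s(p 1, p 2) → w s(c, d) < w s(b, c)) →
      (W s(p 1, p 2) < W s(p 2, p 3) → w s(b, c) < w s(c, d)) →
      w s(a, b) < w s(c, d) → _ := fun {a b c d} h i₁ i₂ i₃ i₄ i₅ => fin a b c d h (by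
    intro e he e' he'
    rcases hE e he with rfl | rfl | rfl <;> rcases hE e' he' with rfl | rfl | rfl <;>
      simp only [Sym2.map_mk, Matrix.cons_val] <;> first | assumption | omega)
  rcases lt_or_gt_of_ne n₁₂ with h | h
  · rcases lt_or_gt_of_ne n₂₃ with h' | h'
    · obtain ⟨a, b, c, d, hP, h₁, h₂⟩ := exists_path_monotone hw hx hS
      exact fin' hP (by omega) (by omega) (by omega) (by omega) (by omega)
    · obtain ⟨a, b, c, d, hP, h₁, h₂⟩ := exists_path_lt_middle hw hx (by omega)
      exact fin' hP (by omega) (by omega) (by omega) (by omega) (by omega)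
  · obtain ⟨a, b, c, d, hP, h₁, h₂⟩ := exists_path_middle_lt hw hx (by omega)
    exact fin' hP (by omega) (by omega) (by omega) (by omega) (by omega)

end Path

end EdgeOrderedGraph

/-! ### Covering by star forests -/

namespace EdgeOrderedGraph

/-- Leaves `P i` and centres `Q j` such that the edge `P i Q j` is dominated by its leaf `P i`,
and such that the edge from `x` to `Q 0` is extreme. -/
theorem exists_leaves_and_centres (K : ℕ) : ∃ n : ℕ, ∀ (t : ℕ) (w : Sym2 (Fin t) → ℤ),
    Set.InjOn w {e | ¬ e.IsDiag} → ∀ (S : Finset (Fin t)) (x : Fin t), x ∈ S → n ≤ S.card →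
    ∃ P Q : ℕ → Fin t, (∀ i < K, P i ∈ S ∧ P i ≠ x) ∧ (∀ i < K, Q i ∈ S ∧ Q i ≠ x) ∧
      (∀ i < K, ∀ j < K, P i = P j → i = j) ∧ (∀ i < K, ∀ j < K, Q i = Q j → i = j) ∧
      (∀ i < K, ∀ j < K, P i ≠ Q j) ∧
      (∀ i i' j j', i < i' → i' < K → j < K → j' < K → j ≠ j' →
        w s(P i, Q j) < w s(P i', Q j')) ∧
      ((∀ i j, i < K → 0 < j → j < K → w s(x, Q 0) < w s(P i, Q j)) ∨
        (∀ i j, i < K → 0 < j → j < K → w s(P i, Q j) < w s(x, Q 0))) := by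
  classical
  obtain ⟨N₁, h₁⟩ := Finset.exists_ramsey_triples (2 * K)
  obtain ⟨N₂, h₂⟩ := Finset.exists_ramsey_quadruples N₁
  obtain ⟨N₃, h₃⟩ := Finset.exists_ramsey_quadruples N₂
  refine ⟨N₃ + 1, fun t w hw S x hx hS => ?_⟩
  -- Three homogeneity conditions in turn: nested pairs of edges, crossing pairs, and an edge at `x`
  -- against an edge that straddles its other end.
  obtain ⟨T₃, hT₃, hc₃, hγ⟩ := h₃ (fun a b c d => w s(a, d) < w s(b, c)) (S.erase x)
    (by rw [Finset.card_erase_of_mem hx]; omega)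
  obtain ⟨T₂, hT₂, hc₂, hδ⟩ := h₂ (fun a b c d => w s(a, c) < w s(b, d)) T₃ hc₃.ge
  obtain ⟨T, hT, hc, hε⟩ := h₁ (fun a b c => w s(x, b) < w s(a, c)) T₂ hc₂.ge
  obtain ⟨p, hpT, hp⟩ : ∃ p : ℕ → Fin t, (∀ i < 2 * K, p i ∈ T) ∧
      ∀ i j, i < j → j < 2 * K → p i < p j := by
    refine ⟨fun i => if h : i < 2 * K then T.orderEmbOfFin hc ⟨i, h⟩ else x, fun i hi => ?_,
      fun i j hij hj => ?_⟩
    · simp [hi]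
    · simp [hj, hij, hij.trans hj]
  have hpS : ∀ i < 2 * K, p i ∈ S ∧ p i ≠ x := fun i hi =>
    (Finset.mem_erase.1 (hT₃ (hT₂ (hT (hpT i hi))))).symm
  have hpinj : ∀ i j, i < 2 * K → j < 2 * K → p i = p j → i = j := by
    intro i j hi hj h
    rcases lt_trichotomy i j with hij | hij | hij
    · exact absurd h (hp i j hij hj).ne
    · exact hij
    · exact absurd h (hp j i hij hi).ne'
  have hpne : ∀ i j, i < j → j < 2 * K → p i ≠ p j := fun i j hij hj => (hp i j hij hj).ne
  have hγ' : (∀ a b c d, a < b → b < c → c < d → d < 2 * K → w s(p a, p d) < w s(p b, p c)) ∨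
      (∀ a b c d, a < b → b < c → c < d → d < 2 * K → w s(p b, p c) < w s(p a, p d)) := by
    refine hγ.imp (fun h a b c d hab hbc hcd hd => ?_) (fun h a b c d hab hbc hcd hd => ?_)
    · exact h _ (hT₂ (hT (hpT a (by omega)))) _ (hT₂ (hT (hpT b (by omega))))
        _ (hT₂ (hT (hpT c (by omega)))) _ (hT₂ (hT (hpT d hd)))
        (hp a b hab (by omega)) (hp b c hbc (by omega)) (hp c d hcd hd)
    · refine lt_of_le_of_ne (not_lt.1 (h _ (hT₂ (hT (hpT a (by omega))))
        _ (hT₂ (hT (hpT b (by omega)))) _ (hT₂ (hT (hpT c (by omega)))) _ (hT₂ (hT (hpT d hd)))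
        (hp a b hab (by omega)) (hp b c hbc (by omega)) (hp c d hcd hd))) (hw.ne ?_ ?_ ?_)
      · simpa using hpne b c hbc (by omega)
      · simpa using hpne a d (by omega) hd
      · have := hpne a b hab (by omega)
        have := hpne b d (by omega) (by omega)
        simp only [ne_eq, Sym2.eq_iff]
        grind
  have hδ' : (∀ a b c d, a < b → b < c → c < d → d < 2 * K → w s(p a, p c) < w s(p b, p d)) ∨
      (∀ a b c d, a < b → b < c → c < d → d < 2 * K → w s(p b, p d) < w s(p a, p c)) := by
    refine hδ.imp (fun h a b c d hab hbc hcd hd => ?_) (fun h a b c d hab hbc hcd hd => ?_)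
    · exact h _ (hT (hpT a (by omega))) _ (hT (hpT b (by omega)))
        _ (hT (hpT c (by omega))) _ (hT (hpT d hd))
        (hp a b hab (by omega)) (hp b c hbc (by omega)) (hp c d hcd hd)
    · refine lt_of_le_of_ne (not_lt.1 (h _ (hT (hpT a (by omega)))
        _ (hT (hpT b (by omega))) _ (hT (hpT c (by omega))) _ (hT (hpT d hd))
        (hp a b hab (by omega)) (hp b c hbc (by omega)) (hp c d hcd hd))) (hw.ne ?_ ?_ ?_)
      · simpa using hpne b d (by omega) (by omega)
      · simpa using hpne a c (by omega) (by omega)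
      · have := hpne a b hab (by omega)
        have := hpne b c hbc (by omega)
        simp only [ne_eq, Sym2.eq_iff]
        grind
  have hε' : (∀ a b c, a < b → b < c → c < 2 * K → w s(x, p b) < w s(p a, p c)) ∨
      (∀ a b c, a < b → b < c → c < 2 * K → w s(p a, p c) < w s(x, p b)) := by
    refine hε.imp (fun h a b c hab hbc hc => ?_) (fun h a b c hab hbc hc => ?_)
    · exact h _ (hpT a (by omega)) _ (hpT b (by omega)) _ (hpT c hc)
        (hp a b hab (by omega)) (hp b c hbc hc)
    · have ha := (hpS a (by omega)).2
      have hc' := (hpS c hc).2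
      refine lt_of_le_of_ne (not_lt.1 (h _ (hpT a (by omega)) _ (hpT b (by omega)) _ (hpT c hc)
        (hp a b hab (by omega)) (hp b c hbc hc))) (hw.ne ?_ ?_ ?_)
      · simpa using hpne a c (by omega) hc
      · simpa using (hpS b (by omega)).2.symm
      · simp only [ne_eq, Sym2.eq_iff]
        grind
  have swap : ∀ i j, s(p i, p j) = s(p j, p i) := fun i j => Sym2.eq_swap
  have fin : ∀ a b : ℕ → ℕ, (∀ i < K, a i < 2 * K) → (∀ i < K, b i < 2 * K) →
      (∀ i < K, ∀ j < K, a i = a j → i = j) → (∀ i < K, ∀ j < K, b i = b j → i = j) →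
      (∀ i < K, ∀ j < K, a i ≠ b j) →
      (∀ i i' j j', i < i' → i' < K → j < K → j' < K → j ≠ j' →
        w s(p (a i), p (b j)) < w s(p (a i'), p (b j'))) →
      (∀ i j, i < K → 0 < j → j < K → a i < b 0 ∧ b 0 < b j ∨ b j < b 0 ∧ b 0 < a i) →
      ∃ P Q : ℕ → Fin t, (∀ i < K, P i ∈ S ∧ P i ≠ x) ∧ (∀ i < K, Q i ∈ S ∧ Q i ≠ x) ∧
        (∀ i < K, ∀ j < K, P i = P j → i = j) ∧ (∀ i < K, ∀ j < K, Q i = Q j → i = j) ∧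
        (∀ i < K, ∀ j < K, P i ≠ Q j) ∧
        (∀ i i' j j', i < i' → i' < K → j < K → j' < K → j ≠ j' →
          w s(P i, Q j) < w s(P i', Q j')) ∧
        ((∀ i j, i < K → 0 < j → j < K → w s(x, Q 0) < w s(P i, Q j)) ∨
          (∀ i j, i < K → 0 < j → j < K → w s(P i, Q j) < w s(x, Q 0))) :=
    fun a b ha hb ha' hb' hab hD hE => ⟨fun i => p (a i), fun j => p (b j),
      fun i hi => hpS _ (ha i hi), fun i hi => hpS _ (hb i hi),
      fun i hi j hj h => ha' i hi j hj (hpinj _ _ (ha i hi) (ha j hj) h),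
      fun i hi j hj h => hb' i hi j hj (hpinj _ _ (hb i hi) (hb j hj) h),
      fun i hi j hj h => hab i hi j hj (hpinj _ _ (ha i hi) (hb j hj) h), hD,
      hε'.imp
        (fun h i j hi hj hj' => by
          rcases hE i j hi hj hj' with h' | h'
          · exact h _ _ _ h'.1 h'.2 (hb j hj')
          · rw [swap]; exact h _ _ _ h'.1 h'.2 (ha i hi))
        (fun h i j hi hj hj' => by
          rcases hE i j hi hj hj' with h' | h'
          · exact h _ _ _ h'.1 h'.2 (hb j hj')
          · rw [swap]; exact h _ _ _ h'.1 h'.2 (ha i hi))⟩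
  -- The nested and crossing types decide which half of the points are leaves and in which direction
  -- they are numbered. Centres are numbered outwards from the middle, so `Q 0` always separates the
  -- leaves from the other centres, as the condition on `x` needs.
  rcases hγ' with hγ' | hγ' <;> rcases hδ' with hδ' | hδ'
  · refine fin (fun i => i) (fun j => K + j) ?_ ?_ ?_ ?_ ?_ ?_ ?_
    iterate 5 intros; omega
    · intro i i' j j' hi hi' hj hj' hne
      rcases lt_or_gt_of_ne hne with h | h
      · exact hδ' _ _ _ _ hi (by omega) (by omega) (by omega)
      · exact hγ' _ _ _ _ hi (by omega) (by omega) (by omega)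
    · intros; omega
  · refine fin (fun i => 2 * K - 1 - i) (fun j => K - 1 - j) ?_ ?_ ?_ ?_ ?_ ?_ ?_
    iterate 5 intros; omega
    · intro i i' j j' hi hi' hj hj' hne
      rw [swap (2 * K - 1 - i), swap (2 * K - 1 - i')]
      rcases lt_or_gt_of_ne hne with h | h
      · exact hδ' _ _ _ _ (by omega) (by omega) (by omega) (by omega)
      · exact hγ' _ _ _ _ (by omega) (by omega) (by omega) (by omega)
    · intros; omega
  · refine fin (fun i => K + i) (fun j => K - 1 - j) ?_ ?_ ?_ ?_ ?_ ?_ ?_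
    iterate 5 intros; omega
    · intro i i' j j' hi hi' hj hj' hne
      rw [swap (K + i), swap (K + i')]
      rcases lt_or_gt_of_ne hne with h | h
      · exact hγ' _ _ _ _ (by omega) (by omega) (by omega) (by omega)
      · exact hδ' _ _ _ _ (by omega) (by omega) (by omega) (by omega)
    · intros; omega
  · refine fin (fun i => K - 1 - i) (fun j => K + j) ?_ ?_ ?_ ?_ ?_ ?_ ?_
    iterate 5 intros; omega
    · intro i i' j j' hi hi' hj hj' hne
      rcases lt_or_gt_of_ne hne with h | h
      · exact hγ' _ _ _ _ (by omega) (by omega) (by omega) (by omega)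
      · exact hδ' _ _ _ _ (by omega) (by omega) (by omega) (by omega)
    · intros; omega

theorem CoversVertices.of_isStarForest {V : Type*} [Fintype V] [Nonempty V]
    (F : EdgeOrderedGraph V) (hF : IsStarForest F.graph) : F.CoversVertices := by
  classical
  obtain ⟨r, hrr, hadj⟩ := hF.exists_centre
  obtain ⟨W, hW⟩ := F.exists_label
  obtain ⟨M, hM⟩ := (Set.finite_range W).bddAbove
  have hM : ∀ e, W e ≤ M := fun e => hM ⟨e, rfl⟩
  let L : V → ℕ := fun v => W s(v, r v)
  have hL : ∀ v, L v ≤ M := fun v => hM _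
  have hleaf : ∀ v, r v ≠ v → s(v, r v) ∈ F.graph.edgeSet := fun v hv =>
    (hadj _ _).2 ⟨hv.symm, .inl rfl⟩
  have hLinj : ∀ u v, r u ≠ u → r v ≠ v → L u = L v → u = v := by
    intro u v hu hv h
    by_contra hne
    refine label_ne hW (hleaf u hu) (hleaf v hv) (fun h' => ?_) h
    rcases Sym2.eq_iff.1 h' with h' | h'
    · exact hne h'.1
    · exact hu (by rw [h'.1, hrr])
  have hedge : ∀ e : F.graph.edgeSet, ∃ u, r u ≠ u ∧ e.1 = s(u, r u) := by
    rintro ⟨e, he⟩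
    induction e with | _ u v
    obtain ⟨hne, h | h⟩ := (hadj u v).1 he
    · exact ⟨u, by rw [h]; exact hne.symm, by rw [h]⟩
    · exact ⟨v, by rw [h]; exact hne, by rw [h]; exact Sym2.eq_swap⟩
  have hext : ∀ (γ : Type) [LinearOrder γ] (g : ℕ → γ), ∃ v₀, ∀ v, r v ≠ v →
      r v₀ ≠ v₀ ∧ g (L v₀) ≤ g (L v) := by
    intro γ _ g
    by_cases h : ∃ v, r v ≠ v
    · obtain ⟨v, hv⟩ := h
      obtain ⟨v₀, h₀, hmin⟩ := Finset.exists_min_image (Finset.univ.filter fun v => r v ≠ v)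
        (fun v => g (L v)) ⟨v, by simpa⟩
      exact ⟨v₀, fun v hv => ⟨by simpa using h₀, hmin v (by simpa)⟩⟩
    · exact ⟨Classical.arbitrary V, fun v hv => (h ⟨v, hv⟩).elim⟩
  let q := Fintype.equivFin V
  -- Leaves use the odd indices `2 * L v + 1`, at most `2 * M + 1`, so `0` and `2 * M + 2` stay
  -- spare. Centre indices are at most `Fintype.card V`.
  obtain ⟨n, hn⟩ := exists_leaves_and_centres (2 * M + Fintype.card V + 3)
  refine ⟨n, fun t w hw S x hx hS => ?_⟩
  obtain ⟨P, Q, hP, hQ, hPi, hQi, hPQ, hD, hx'⟩ := hn t w hw S x hx hS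
  set K := 2 * M + Fintype.card V + 3 with hK
  have hV : 0 < Fintype.card V := Fintype.card_pos
  -- Domination by the leaf is only known for different centres. With a gap of two, edges at the
  -- same centre are compared through an intermediate leaf and another centre.
  have hgap : ∀ i i' j j', i + 2 ≤ i' → i' < K → j < K → j' < K →
      w s(P i, Q j) < w s(P i', Q j') := by
    intro i i' j j' hi hi' hj hj'
    by_cases hjj : j = j'
    · subst hjj
      obtain ⟨l, hl, hlj⟩ : ∃ l < K, l ≠ j := by
        by_cases h : j = 0
        · exact ⟨1, by omega, by omega⟩
        · exact ⟨0, by omega, by omega⟩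
      exact (hD i (i + 1) j l (by omega) (by omega) hj hl hlj.symm).trans
        (hD (i + 1) i' l j (by omega) hi' hl hj hlj)
    · exact hD i i' j j' (by omega) hi' hj hj' hjj
  -- The leaf `v₀` of an extreme edge goes to `x` and its centre to `Q 0`. If there are no edges,
  -- `v₀` is arbitrary and the order condition is vacuous.
  have key : ∀ v₀ : V,
      (∀ u, r u ≠ u → L v₀ < L u → ∀ j < K,
        w s(x, Q 0) < w s(P (2 * L u + 1), Q j)) →
      (∀ u, r u ≠ u → L u < L v₀ → ∀ j < K,
        w s(P (2 * L u + 1), Q j) < w s(x, Q 0)) →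
      (∀ v, r v ≠ v → r v₀ ≠ v₀) →
      ∃ φ : V → Fin t, Function.Injective φ ∧ (∀ v, φ v ∈ S) ∧ (∃ v, φ v = x) ∧
        ∀ e e' : F.graph.edgeSet, F.order.lt e e' → w (e.1.map φ) < w (e'.1.map φ) := by
    intro v₀ hlo hhi hv₀
    let k : V → ℕ := fun v => if v = r v₀ then 0 else q v + 1
    have hkK : ∀ v, k v < K := fun v => by
      have := (q v).2
      simp only [k]
      split_ifs <;> omega
    have hki : ∀ u v, k u = k v → u = v := by
      intro u v h
      simp only [k] at h
      split_ifs at h with h₁ h₂ h₂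
      · rw [h₁, h₂]
      · exact q.injective (Fin.ext (by omega))
    have hLK : ∀ v, 2 * L v + 1 < K := fun v => by have := hL v; omega
    let φ : V → Fin t := fun v =>
      if v = v₀ then x else if r v = v then Q (k v) else P (2 * L v + 1)
    have hφ₀ : φ v₀ = x := by simp [φ]
    have hφQ : ∀ v, v ≠ v₀ → r v = v → φ v = Q (k v) := fun v h h' => by simp [φ, h, h']
    have hφP : ∀ v, v ≠ v₀ → r v ≠ v → φ v = P (2 * L v + 1) := fun v h h' => by simp [φ, h, h']
    have hφx : ∀ v, v ≠ v₀ → φ v ∈ S ∧ φ v ≠ x := by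
      intro v hv
      by_cases h : r v = v
      · rw [hφQ v hv h]; exact hQ _ (hkK v)
      · rw [hφP v hv h]; exact hP _ (hLK v)
    refine ⟨φ, ?_, ?_, ⟨v₀, hφ₀⟩, ?_⟩
    · intro u v huv
      by_cases hu : u = v₀ <;> by_cases hv : v = v₀
      · rw [hu, hv]
      · rw [hu, hφ₀] at huv
        exact absurd huv.symm (hφx v hv).2
      · rw [hv, hφ₀] at huv
        exact absurd huv (hφx u hu).2
      by_cases hu' : r u = u <;> by_cases hv' : r v = v
      · rw [hφQ u hu hu', hφQ v hv hv'] at huv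
        exact hki u v (hQi _ (hkK u) _ (hkK v) huv)
      · rw [hφQ u hu hu', hφP v hv hv'] at huv
        exact absurd huv.symm (hPQ _ (hLK v) _ (hkK u))
      · rw [hφP u hu hu', hφQ v hv hv'] at huv
        exact absurd huv (hPQ _ (hLK u) _ (hkK v))
      · rw [hφP u hu hu', hφP v hv hv'] at huv
        have := hPi _ (hLK u) _ (hLK v) huv
        exact hLinj u v hu' hv' (by omega)
    · intro v
      by_cases hv : v = v₀
      · rw [hv, hφ₀]; exact hx
      · exact (hφx v hv).1
    · intro e e' hee
      rw [← hW] at hee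
      obtain ⟨u, hu, he⟩ := hedge e
      obtain ⟨v, hv, he'⟩ := hedge e'
      rw [he, he'] at hee ⊢
      have hee : L u < L v := hee
      have h₀ := hv₀ u hu
      have hr : ∀ v, φ (r v) = Q (k (r v)) := fun v =>
        hφQ _ (fun h => h₀ (by rw [← h, hrr])) (hrr v)
      rw [Sym2.map_mk, Sym2.map_mk, hr, hr]
      by_cases hu₀ : u = v₀
      · have hv' : v ≠ v₀ := by rintro rfl; rw [hu₀] at hee; exact lt_irrefl _ hee
        have hk₀ : k (r u) = 0 := by simp [k, hu₀]
        rw [hφP v hv' hv, hk₀, hu₀, hφ₀]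
        exact hlo v hv (hu₀ ▸ hee) _ (hkK _)
      by_cases hv' : v = v₀
      · have hk₀ : k (r v) = 0 := by simp [k, hv']
        rw [hφP u hu₀ hu, hk₀, hv', hφ₀]
        exact hhi u hu (hv' ▸ hee) _ (hkK _)
      · rw [hφP u hu₀ hu, hφP v hv' hv]
        exact hgap _ _ _ _ (by omega) (hLK v) (hkK _) (hkK _)
  rcases hx' with hx' | hx'
  · obtain ⟨v₀, h₀⟩ := hext ℕ id
    refine key v₀ (fun u hu hlt j hj => ?_) (fun u hu hlt j hj => ?_)
      fun v hv => (h₀ v hv).1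
    · have := hL u
      by_cases hj₀ : j = 0
      -- Other leaves may share the centre `Q 0`, where `hx'` is silent; the spare leaf `P 0` with
      -- centre `Q 1` bridges the comparison.
      · exact (hx' 0 1 (by omega) one_pos (by omega)).trans
          (hD _ _ _ _ (by omega) (by omega) (by omega) hj (by omega))
      · exact hx' _ j (by omega) (by omega) hj
    · exact absurd hlt (not_lt.2 (h₀ u hu).2)
  · obtain ⟨v₀, h₀⟩ := hext ℕᵒᵈ OrderDual.toDual
    refine key v₀ (fun u hu hlt j hj => ?_) (fun u hu hlt j hj => ?_)
      fun v hv => (h₀ v hv).1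
    · exact absurd hlt (not_lt.2 (h₀ u hu).2)
    · have := hL u
      by_cases hj₀ : j = 0
      -- Here the bridge is the spare leaf at the upper end.
      · exact (hD _ (2 * M + 2) _ 1 (by omega) (by omega) hj (by omega) (by omega)).trans
          (hx' _ 1 (by omega) one_pos (by omega))
      · exact hx' _ j (by omega) (by omega) hj

end EdgeOrderedGraph

/-! ### The equivalence -/

theorem theorem1p5 {V : Type*} [Fintype V] [Nonempty V] (H : SimpleGraph V) :
    List.TFAE [
      UniversallyTileable H,
      UniversallyTuranable H,
      IsStarForest H ∨ IsThreeEdgePathWithIsolated H ∨ IsTriangleWithIsolated H] := by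
  tfae_have 1 → 2 := fun h o => (h o).turanable
  tfae_have 2 → 3 := fun h => h.isStarForest_or
  tfae_have 3 → 1 := by
    rintro (h | ⟨m, ⟨e⟩⟩ | ⟨m, ⟨e⟩⟩) o
    · exact (EdgeOrderedGraph.CoversVertices.of_isStarForest ⟨H, o⟩ h).tileable
    · obtain ⟨p, hp⟩ := SimpleGraph.exists_eq_map_of_iso_sum_bot e
      exact (EdgeOrderedGraph.CoversVertices.of_path ⟨H, o⟩ p hp).tileable
    · obtain ⟨p, hp⟩ := SimpleGraph.exists_eq_map_of_iso_sum_bot e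
      exact (EdgeOrderedGraph.CoversVertices.of_triangle ⟨H, o⟩ p hp).tileable
  tfae_finish
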